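/- Let $\mathcal A$ be a unital $C^*$-algebra and let $\mathcal B$ be a von Neumann algebra acting on a Hilbert space. Write $UCP(\mathcal A,\mathcal B)$ for the set of unital completely positive maps $\mathcal A\to\mathcal B$. A joint representation tuple of $\phi_1,\phi_2\in UCP(\mathcal A,\mathcal B)$ is a quadruple $(\mathcal E,\sigma_1,\sigma_2,x)$ consisting of a (complete) right Hilbert $\mathcal B$-module $\mathcal E$, two unital $*$-homomorphisms $\sigma_1,\sigma_2$ from $\mathcal A$ to the $C^*$-algebra $\mathcal B^a(\mathcal E)$ of bounded adjointable operators on $\mathcal E$, and a vector $x\in\mathcal E$ with $\langle x,x\rangle=1$, such that $\phi_i(a)=\langle x,\sigma_i(a)x\rangle$ for all $a\in\mathcal A$ and $i=1,2$. Define $$\gamma(\phi_1,\phi_2)=\inf\|\sigma_1-\sigma_2\|_{cb},$$ where the infimum is over all joint representation tuples of $\phi_1,\phi_2$ and $\|\cdot\|_{cb}$ is the completely bounded norm. Then $\gamma$ is a metric on $UCP(\mathcal A,\mathcal B)$: for all $\phi,\psi,\chi\in UCP(\mathcal A,\mathcal B)$ one has $0\le\gamma(\phi,\psi)<\infty$;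 $\gamma(\phi,\psi)=0$ if and only if $\phi=\psi$; $\gamma(\phi,\psi)=\gamma(\psi,\phi)$; and $\gamma(\phi,\chi)\le\gamma(\phi,\psi)+\gamma(\psi,\chi)$. Moreover $\gamma(\phi,\psi)\ge\|\phi-\psi\|$ and $\gamma(\phi,\psi)\ge\|\phi-\psi\|_{cb}$. -/

import Mathlib

open scoped CStarAlgebra InnerProductSpace ENNReal

universe u v

noncomputable section

/-! ## The C⋆-algebra of adjointable operators on a Hilbert C⋆-module

Mathlib's class `CStarModule C E` makes `E` a *left* Hilbert `C`-module: its inner product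
satisfies `⟪x, c • y⟫ = c * ⟪x, y⟫`.  A *right* Hilbert `B`-module is the same thing as a left
Hilbert module over the opposite algebra `Bᵐᵒᵖ`, and it is in this form,
`[Module Bᵐᵒᵖ E] [CStarModule Bᵐᵒᵖ E]`, that right Hilbert modules appear below.  The `B`-valued
inner product is then `MulOpposite.unop ⟪x, y⟫`; it satisfies `⟨x, y b⟩ = ⟨x, y⟩ b`. -/

set_option linter.unusedSectionVars false

namespace HilbertModule

section Adjointable

variable (C : Type*) (E : Type*) [CStarAlgebra C] [PartialOrder C] [StarOrderedRing C]
  [NormedAddCommGroup E] [NormedSpace ℂ E] [Module C E] [CStarModule C E]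

/-- The bounded operators on `E` that have a bounded adjoint for the `C`-valued inner product.
(Such operators are automatically `C`-linear, see `HilbertModule.Adjointable.map_smul`.) -/
def adjointableSubalgebra : Subalgebra ℂ (E →L[ℂ] E) where
  carrier := {T | ∃ S : E →L[ℂ] E, ∀ x y : E, ⟪T x, y⟫_C = ⟪x, S y⟫_C}
  mul_mem' := by
    rintro T₁ T₂ ⟨S₁, h₁⟩ ⟨S₂, h₂⟩
    exact ⟨S₂ * S₁, fun x y => by simp [h₁, h₂]⟩
  add_mem' := by
    rintro T₁ T₂ ⟨S₁, h₁⟩ ⟨S₂, h₂⟩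
    exact ⟨S₁ + S₂, fun x y => by simp [h₁, h₂]⟩
  algebraMap_mem' z := ⟨algebraMap ℂ _ (star z), fun x y => by
    simp [Algebra.algebraMap_eq_smul_one]⟩

/-- The algebra `B^a(E)` of all bounded adjointable operators on the Hilbert C⋆-module `E`, with
the operator norm. -/
def Adjointable : Type _ := ↥(adjointableSubalgebra C E)

namespace Adjointable

instance : NormedRing (Adjointable C E) :=
  inferInstanceAs (NormedRing ↥(adjointableSubalgebra C E))

instance : NormedAlgebra ℂ (Adjointable C E) :=
  inferInstanceAs (NormedAlgebra ℂ ↥(adjointableSubalgebra C E))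

variable {C E}

/-- The underlying bounded operator. -/
def toCLM (T : Adjointable C E) : E →L[ℂ] E := T.1

instance : FunLike (Adjointable C E) E E where
  coe T := T.toCLM
  coe_injective := fun _ _ h => Subtype.ext (DFunLike.coe_injective h)

theorem toCLM_apply (T : Adjointable C E) (x : E) : T.toCLM x = T x := rfl

theorem norm_def (T : Adjointable C E) : ‖T‖ = ‖T.toCLM‖ := rfl

theorem add_apply (S T : Adjointable C E) (x : E) : (S + T) x = S x + T x := rfl

theorem mul_apply (S T : Adjointable C E) (x : E) : (S * T) x = S (T x) := rfl

theorem smul_apply (z : ℂ) (T : Adjointable C E) (x : E) : (z • T) x = z • T x := rfl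

variable (C) in
theorem ext_inner {x y : E} (h : ∀ z : E, ⟪z, x⟫_C = ⟪z, y⟫_C) : x = y := by
  rw [← sub_eq_zero, ← CStarModule.inner_self (A := C), CStarModule.inner_sub_right, h, sub_self]

/-- The adjoint of an adjointable operator. -/
instance : Star (Adjointable C E) where
  star T := ⟨T.2.choose, T.toCLM, fun x y => by
    rw [← CStarModule.star_inner]
    exact (congrArg star (T.2.choose_spec y x)).symm.trans (CStarModule.star_inner _ _)⟩

theorem inner_apply_left (T : Adjointable C E) (x y : E) :
    ⟪T x, y⟫_C = ⟪x, star T y⟫_C :=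
  T.2.choose_spec x y

theorem inner_apply_right (T : Adjointable C E) (x y : E) :
    ⟪x, T y⟫_C = ⟪star T x, y⟫_C := by
  rw [← CStarModule.star_inner, inner_apply_left, CStarModule.star_inner]

theorem eq_star_of_inner (T S : Adjointable C E)
    (h : ∀ x y : E, ⟪T x, y⟫_C = ⟪x, S y⟫_C) : S = star T := by
  refine DFunLike.ext _ _ fun y => ext_inner C fun x => ?_
  rw [← h, inner_apply_left]

theorem map_smul (T : Adjointable C E) (c : C) (x : E) : T (c • x) = c • T x := by
  refine ext_inner C fun z => ?_
  rw [inner_apply_right, CStarModule.inner_op_smul_right, CStarModule.inner_op_smul_right,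
    inner_apply_right]

instance : StarRing (Adjointable C E) where
  star_involutive T := by
    refine (eq_star_of_inner _ _ fun x y => ?_).symm
    rw [inner_apply_right]
  star_mul T S := by
    refine (eq_star_of_inner _ _ fun x y => ?_).symm
    rw [mul_apply, mul_apply, inner_apply_left, inner_apply_left]
  star_add T S := by
    refine (eq_star_of_inner _ _ fun x y => ?_).symm
    rw [add_apply, add_apply, CStarModule.inner_add_left, CStarModule.inner_add_right,
      inner_apply_left, inner_apply_left]

instance : StarModule ℂ (Adjointable C E) where
  star_smul z T := by
    refine (eq_star_of_inner _ _ fun x y => ?_).symm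
    rw [smul_apply, smul_apply, CStarModule.inner_smul_left_complex,
      CStarModule.inner_smul_right_complex, inner_apply_left]

instance : CStarRing (Adjointable C E) where
  norm_mul_self_le T := by
    have key : ∀ x : E, ‖T x‖ ≤ √‖star T * T‖ * ‖x‖ := fun x => by
      have h1 : ‖T x‖ ^ 2 ≤ ‖star T * T‖ * ‖x‖ ^ 2 := by
        rw [CStarModule.norm_sq_eq C, inner_apply_left]
        calc ‖⟪x, (star T * T) x⟫_C‖ ≤ ‖x‖ * ‖(star T * T) x‖ :=
              CStarModule.norm_inner_le E
          _ ≤ ‖x‖ * (‖star T * T‖ * ‖x‖) := by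
              gcongr
              exact (star T * T).toCLM.le_opNorm x
          _ = ‖star T * T‖ * ‖x‖ ^ 2 := by ring
      refine (sq_le_sq₀ (norm_nonneg _) (by positivity)).1 ?_
      rwa [mul_pow, Real.sq_sqrt (norm_nonneg _)]
    have h2 : ‖T‖ ≤ √‖star T * T‖ := T.toCLM.opNorm_le_bound (Real.sqrt_nonneg _) key
    calc ‖T‖ * ‖T‖ ≤ √‖star T * T‖ * √‖star T * T‖ := by gcongr
      _ = ‖star T * T‖ := Real.mul_self_sqrt (norm_nonneg _)

theorem isClosed_adjointableSubalgebra [CompleteSpace E] :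
    IsClosed (adjointableSubalgebra C E : Set (E →L[ℂ] E)) := by
  refine isClosed_of_closure_subset fun T hT => ?_
  obtain ⟨t, ht, hlim⟩ := mem_closure_iff_seq_limit.1 hT
  let t' : ℕ → Adjointable C E := fun n => ⟨t n, ht n⟩
  have hs : CauchySeq fun n => (star (t' n)).toCLM := by
    have hc := hlim.cauchySeq
    rw [Metric.cauchySeq_iff] at hc ⊢
    intro ε hε
    obtain ⟨N, hN⟩ := hc ε hε
    refine ⟨N, fun m hm n hn => ?_⟩
    have := hN m hm n hn
    rw [dist_eq_norm] at this ⊢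
    calc ‖(star (t' m)).toCLM - (star (t' n)).toCLM‖ = ‖star (t' m) - star (t' n)‖ := rfl
      _ = ‖t' m - t' n‖ := by rw [← star_sub, norm_star]
      _ < ε := this
  obtain ⟨S, hS⟩ := cauchySeq_tendsto_of_complete hs
  refine ⟨S, fun x y => ?_⟩
  have hcont : Continuous fun p : E × E => ⟪p.1, p.2⟫_C := CStarModule.continuous_inner
  have h1 : Filter.Tendsto (fun n => ⟪t n x, y⟫_C) Filter.atTop (nhds ⟪T x, y⟫_C) :=
    (hcont.tendsto (T x, y)).comp
      ((((ContinuousLinearMap.apply ℂ E x).continuous.tendsto T).comp hlim).prodMk_nhds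
        tendsto_const_nhds)
  have h2 : Filter.Tendsto (fun n => ⟪x, (star (t' n)).toCLM y⟫_C) Filter.atTop
      (nhds ⟪x, S y⟫_C) :=
    (hcont.tendsto (x, S y)).comp
      (tendsto_const_nhds.prodMk_nhds
        (((ContinuousLinearMap.apply ℂ E y).continuous.tendsto S).comp hS))
  exact tendsto_nhds_unique h1 (h2.congr fun n => (inner_apply_left (t' n) x y).symm)

instance [CompleteSpace E] : CompleteSpace (Adjointable C E) :=
  (isClosed_adjointableSubalgebra (C := C) (E := E)).completeSpace_coe

instance [CompleteSpace E] : CStarAlgebra (Adjointable C E) where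

/-- The usual order of a C⋆-algebra: `S ≤ T` iff `T - S` is a positive element. -/
instance [CompleteSpace E] : PartialOrder (Adjointable C E) :=
  CStarAlgebra.spectralOrder (Adjointable C E)

instance [CompleteSpace E] : StarOrderedRing (Adjointable C E) :=
  CStarAlgebra.spectralOrderedRing (Adjointable C E)

end Adjointable

end Adjointable

end HilbertModule

/-! ## Norms of linear maps, unital completely positive maps -/

section Maps

variable {A : Type*} {D : Type*} [CStarAlgebra A] [PartialOrder A] [StarOrderedRing A]
  [CStarAlgebra D] [PartialOrder D] [StarOrderedRing D]

/-- The operator norm `‖f‖ = sup {‖f a‖ : ‖a‖ ≤ 1}` of a linear map, with values in `[0, ∞]`. -/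
def opENorm (f : A →ₗ[ℂ] D) : ℝ≥0∞ :=
  ⨆ (a : A) (_ : ‖a‖ ≤ 1), ‖f a‖ₑ

/-- The completely bounded norm `‖f‖_cb = sup {‖[f (M i j)]‖ : n ∈ ℕ, M ∈ M_n(A), ‖M‖ ≤ 1}` of a
linear map, with values in `[0, ∞]`.  Here `CStarMatrix (Fin n) (Fin n) A` is the C⋆-algebra
`M_n(A)`. -/
def cbENorm (f : A →ₗ[ℂ] D) : ℝ≥0∞ :=
  ⨆ (n : ℕ) (M : CStarMatrix (Fin n) (Fin n) A) (_ : ‖M‖ ≤ 1), ‖M.map f‖ₑ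

variable (A D) in
/-- The set `UCP(A, D)` of unital completely positive maps. -/
abbrev UCP : Type _ := {φ : A →CP D // φ 1 = 1}

end Maps

/-! ## The representation distance -/

section Representation

variable {A : Type u} {B : Type v} [CStarAlgebra A] [PartialOrder A] [StarOrderedRing A]
  [CStarAlgebra B] [PartialOrder B] [StarOrderedRing B]

/-- A joint representation tuple `(E, σ₁, σ₂, x)` of `φ₁, φ₂`: a (complete) right Hilbert
`B`-module `E` with two unital left actions of `A` by adjointable operators and a unit vector `x`
such that `φᵢ(a) = ⟨x, σᵢ(a) x⟩`.

The module is taken in the universe `max u v`.  This is no restriction for the infimum below: the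
closed submodule generated by `x` under both actions and `B` is again the module of such a tuple,
with no larger `‖σ₁ - σ₂‖_cb`, and it has a copy in that universe. -/
structure JointRepresentation (φ₁ φ₂ : UCP A B) where
  E : Type (max u v)
  [normedAddCommGroup : NormedAddCommGroup E]
  [normedSpace : NormedSpace ℂ E]
  [module : Module Bᵐᵒᵖ E]
  [cstarModule : CStarModule Bᵐᵒᵖ E]
  [completeSpace : CompleteSpace E]
  σ₁ : A →⋆ₐ[ℂ] HilbertModule.Adjointable Bᵐᵒᵖ E
  σ₂ : A →⋆ₐ[ℂ] HilbertModule.Adjointable Bᵐᵒᵖ E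
  x : E
  inner_self_x : MulOpposite.unop ⟪x, x⟫_Bᵐᵒᵖ = 1
  apply_left : ∀ a : A, φ₁.1 a = MulOpposite.unop ⟪x, σ₁ a x⟫_Bᵐᵒᵖ
  apply_right : ∀ a : A, φ₂.1 a = MulOpposite.unop ⟪x, σ₂ a x⟫_Bᵐᵒᵖ

attribute [instance] JointRepresentation.normedAddCommGroup JointRepresentation.normedSpace
  JointRepresentation.module JointRepresentation.cstarModule JointRepresentation.completeSpace

/-- The distance `‖σ₁ - σ₂‖_cb` of the two left actions of a joint representation tuple. -/
def JointRepresentation.cbDist {φ₁ φ₂ : UCP A B} (J : JointRepresentation φ₁ φ₂) : ℝ≥0∞ :=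
  cbENorm (J.σ₁.toAlgHom.toLinearMap - J.σ₂.toAlgHom.toLinearMap)

/-- The representation distance `γ(φ₁, φ₂)`: the infimum of `‖σ₁ - σ₂‖_cb` over all joint
representation tuples of `φ₁, φ₂` (it would be `∞` if there were none). -/
def representationDist (φ₁ φ₂ : UCP A B) : ℝ≥0∞ :=
  ⨅ J : JointRepresentation φ₁ φ₂, J.cbDist

end Representation

end

set_option linter.unusedSectionVars false

universe w

noncomputable section

/-! ## Completely bounded norms -/

/-! The upper bounds for `γ` come from trading Hilbert modules for Hilbert spaces. Let `N` be the
commutant of `B` on `G`. A joint tuple on `E` yields `H = E ⊗_B G` with two representations of `A`,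
an action of `N` commuting with both, and the isometry `V : g ↦ x ⊗ g`, which intertwines the
actions of `N`. Conversely, given such data on `H`, the operators `T : G → H` intertwining the
actions of `N` form a Hilbert `B`-module under `S⋆T`: this operator commutes with `N`, hence lies in
`B` by the bicommutant property. Since ⋆-homomorphisms are completely contractive, neither passage
increases `‖σ₁ - σ₂‖_cb` (`exists_of_jointRepresentation`, `representationDist_le`). The gain is
that closed subspaces of Hilbert spaces are complemented, while closed submodules need not be.

For the triangle inequality take data `(σ₁, σ₂, V)` on `H₁` for `φ, ψ` and `(τ₁, τ₂, W)` on `H₂` for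
`ψ, χ`. The minimal Stinespring space of `ψ` embeds isometrically in both. Let `U` be the symmetry
of `H₁ ⊕ H₂` that exchanges the two copies and fixes their complement. It carries `(V g, 0)` to `(0,
W g)`, and it commutes with `N` and with `β = σ₂ ⊕ τ₁`, because `σ₂` and `τ₁` restrict to the same
representation on the copies. So `σ₁ ⊕ τ₁` and `U (σ₂ ⊕ τ₂) U`, with the isometry `g ↦ (V g, 0)`,
represent `φ` and `χ`. The first differs from `β` by `(σ₁ - σ₂) ⊕ 0` and the second by a conjugate
of `0 ⊕ (τ₁ - τ₂)` (`cbDist_glue_le`). Gluing Stinespring representations along `G` alone gives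
finiteness, and a Stinespring representation taken twice gives `γ(φ, φ) = 0`.

The lower bounds hold because the compression `T ↦ ⟨x, T x⟩` by a unit vector is completely
contractive (`norm_compression_le`); definiteness follows from them. -/

theorem norm_one_le_one (D : Type*) [CStarAlgebra D] : ‖(1 : D)‖ ≤ 1 := by
  -- Equality can fail: `D` may be the zero algebra, such as the matrices of size `0`.
  have h : ‖(1 : D)‖ = ‖(1 : D)‖ * ‖(1 : D)‖ := by
    simpa using CStarRing.norm_star_mul_self (x := (1 : D))
  nlinarith [norm_nonneg (1 : D)]

section CBNorm

variable {A D D' : Type*} [CStarAlgebra A] [PartialOrder A] [StarOrderedRing A]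
  [CStarAlgebra D] [PartialOrder D] [StarOrderedRing D]
  [CStarAlgebra D'] [PartialOrder D'] [StarOrderedRing D']

theorem cbENorm_le_of_forall {f : A →ₗ[ℂ] D} {C : ℝ≥0∞}
    (h : ∀ (n : ℕ) (M : CStarMatrix (Fin n) (Fin n) A), ‖M‖ ≤ 1 → ‖M.map f‖ₑ ≤ C) :
    cbENorm f ≤ C :=
  iSup_le fun n => iSup_le fun M => iSup_le fun hM => h n M hM

theorem enorm_map_le_cbENorm (f : A →ₗ[ℂ] D) {n : ℕ} (M : CStarMatrix (Fin n) (Fin n) A)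
    (hM : ‖M‖ ≤ 1) : ‖M.map f‖ₑ ≤ cbENorm f :=
  le_iSup_of_le n (le_iSup_of_le M (le_iSup_of_le hM le_rfl))

theorem cbENorm_mono {f : A →ₗ[ℂ] D} {g : A →ₗ[ℂ] D'}
    (h : ∀ (n : ℕ) (M : CStarMatrix (Fin n) (Fin n) A), ‖M.map f‖ ≤ ‖M.map g‖) :
    cbENorm f ≤ cbENorm g :=
  cbENorm_le_of_forall fun n M hM =>
    (enorm_le_iff_norm_le.2 (h n M)).trans (enorm_map_le_cbENorm g M hM)

/-- Applying `π` entrywise is a ⋆-homomorphism of matrix algebras, and these are contractive; when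
injective they are isometric. All comparisons of cb norms below rest on these two facts. -/
theorem norm_map_starHom_le (π : D →⋆ₙₐ[ℂ] D') {n : ℕ} (M : CStarMatrix (Fin n) (Fin n) D) :
    ‖M.map π‖ ≤ ‖M‖ :=
  NonUnitalStarAlgHom.norm_apply_le (CStarMatrix.mapₙₐ (n := Fin n) π) M

theorem norm_map_starHom_of_injective (π : D →⋆ₙₐ[ℂ] D') (hπ : Function.Injective π) {n : ℕ}
    (M : CStarMatrix (Fin n) (Fin n) D) : ‖M.map π‖ = ‖M‖ :=
  NonUnitalStarAlgHom.norm_map (CStarMatrix.mapₙₐ (n := Fin n) π)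
    (CStarMatrix.map_injective hπ) M

theorem cbENorm_starHom_comp_le (π : D →⋆ₙₐ[ℂ] D') (f : A →ₗ[ℂ] D) (g : A →ₗ[ℂ] D')
    (h : ∀ a, g a = π (f a)) : cbENorm g ≤ cbENorm f :=
  cbENorm_mono fun n M => by
    have : M.map g = (M.map f).map π := by ext i j; exact h _
    rw [this]
    exact norm_map_starHom_le π _

theorem cbENorm_le_of_injective (π : D →⋆ₙₐ[ℂ] D') (hπ : Function.Injective π)
    (f : A →ₗ[ℂ] D) (g : A →ₗ[ℂ] D') (h : ∀ a, g a = π (f a)) : cbENorm f ≤ cbENorm g :=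
  cbENorm_mono fun n M => by
    have : M.map g = (M.map f).map π := by ext i j; exact h _
    rw [this, norm_map_starHom_of_injective π hπ]

theorem cbENorm_add_le (f g : A →ₗ[ℂ] D) : cbENorm (f + g) ≤ cbENorm f + cbENorm g :=
  cbENorm_le_of_forall fun n M hM => by
    have : M.map (f + g) = M.map f + M.map g := by ext i j; simp
    rw [this]
    exact (enorm_add_le _ _).trans
      (add_le_add (enorm_map_le_cbENorm f M hM) (enorm_map_le_cbENorm g M hM))

theorem cbENorm_neg (f : A →ₗ[ℂ] D) : cbENorm (-f) = cbENorm f := by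
  have key (n : ℕ) (M : CStarMatrix (Fin n) (Fin n) A) : ‖M.map (-f : A →ₗ[ℂ] D)‖ = ‖M.map f‖ := by
    have : M.map (-f : A →ₗ[ℂ] D) = -M.map f := by ext i j; simp
    rw [this, norm_neg]
  exact le_antisymm (cbENorm_mono fun n M => (key n M).le) (cbENorm_mono fun n M => (key n M).ge)

theorem cbENorm_sub_comm (f g : A →ₗ[ℂ] D) : cbENorm (f - g) = cbENorm (g - f) := by
  rw [← neg_sub, cbENorm_neg]

theorem cbENorm_sub_le_sub_add_sub (f g h : A →ₗ[ℂ] D) :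
    cbENorm (f - h) ≤ cbENorm (f - g) + cbENorm (g - h) := by
  rw [← sub_add_sub_cancel f g h]
  exact cbENorm_add_le _ _

theorem cbENorm_starAlgHom_le_one (π : A →⋆ₐ[ℂ] D) : cbENorm π.toAlgHom.toLinearMap ≤ 1 :=
  cbENorm_le_of_forall fun n M hM => by
    rw [← enorm_one (G := ℝ)]
    refine enorm_le_iff_norm_le.2 ?_
    rw [norm_one]
    exact (norm_map_starHom_le (π : A →⋆ₙₐ[ℂ] D) M).trans hM

theorem cbENorm_starAlgHom_sub_le (π ρ : A →⋆ₐ[ℂ] D) :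
    cbENorm (π.toAlgHom.toLinearMap - ρ.toAlgHom.toLinearMap) ≤ 2 := by
  rw [sub_eq_add_neg, ← one_add_one_eq_two]
  refine (cbENorm_add_le _ _).trans (add_le_add (cbENorm_starAlgHom_le_one π) ?_)
  rw [cbENorm_neg]
  exact cbENorm_starAlgHom_le_one ρ

variable (A) in
/-- The identification of `A` with the `1 × 1` matrices over `A`. -/
def oneByOneHom : A →⋆ₙₐ[ℂ] CStarMatrix (Fin 1) (Fin 1) A where
  toFun a := CStarMatrix.ofMatrix fun _ _ => a
  map_smul' _ _ := rfl
  map_zero' := rfl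
  map_add' _ _ := rfl
  map_mul' a b := by ext i j; simp only [CStarMatrix.mul_apply, Fin.sum_univ_one]; rfl
  map_star' _ := rfl

theorem norm_oneByOneHom (a : A) : ‖oneByOneHom A a‖ = ‖a‖ :=
  NonUnitalStarAlgHom.norm_map (oneByOneHom A)
    (fun _ _ h => CStarMatrix.ext_iff.2 h 0 0) a

/-- The case `n = 1` of the supremum. -/
theorem opENorm_le_cbENorm (f : A →ₗ[ℂ] D) : opENorm f ≤ cbENorm f :=
  iSup_le fun a => iSup_le fun ha => by
    have h1 : ‖oneByOneHom D (f a)‖ₑ = ‖f a‖ₑ :=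
      enorm_eq_iff_norm_eq.2 (norm_oneByOneHom (f a))
    rw [← h1]
    exact enorm_map_le_cbENorm f (oneByOneHom A a)
      ((norm_oneByOneHom a).trans_le ha)

end CBNorm

/-! ## Compression by a unit vector of a Hilbert module -/

namespace HilbertModule

/-- No compatibility of the two scalar actions is assumed; it is forced by the inner product, which
separates points. -/
theorem smul_complex_smul {C E : Type*} [CStarAlgebra C] [PartialOrder C] [StarOrderedRing C]
    [NormedAddCommGroup E] [NormedSpace ℂ E] [Module C E] [CStarModule C E]
    (z : ℂ) (c : C) (x : E) : (z • c) • x = z • c • x :=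
  Adjointable.ext_inner C fun w => by simp

theorem norm_smul_le' {C E : Type*} [CStarAlgebra C] [PartialOrder C] [StarOrderedRing C]
    [NormedAddCommGroup E] [NormedSpace ℂ E] [Module C E] [CStarModule C E]
    (c : C) (x : E) : ‖c • x‖ ≤ ‖c‖ * ‖x‖ := by
  refine (sq_le_sq₀ (norm_nonneg _) (by positivity)).1 ?_
  rw [CStarModule.norm_sq_eq C, CStarModule.inner_op_smul_right, CStarModule.inner_op_smul_left]
  calc ‖c * (⟪x, x⟫_C * star c)‖ ≤ ‖c‖ * (‖⟪x, x⟫_C‖ * ‖star c‖) :=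
        (norm_mul_le _ _).trans (by gcongr; exact norm_mul_le _ _)
    _ = (‖c‖ * ‖x‖) ^ 2 := by rw [norm_star, ← CStarModule.norm_sq_eq C]; ring

variable {B E : Type*} [CStarAlgebra B] [PartialOrder B] [StarOrderedRing B]
  [NormedAddCommGroup E] [NormedSpace ℂ E] [Module Bᵐᵒᵖ E] [CStarModule Bᵐᵒᵖ E]

open MulOpposite

/-- The operator `e ↦ x b ⟨x, e⟩`. -/
def rankOneCLM (x : E) (b : B) : E →L[ℂ] E :=
  LinearMap.mkContinuous
    { toFun := fun e => (⟪x, e⟫_Bᵐᵒᵖ * op b) • x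
      map_add' := fun e f => by rw [CStarModule.inner_add_right, add_mul, add_smul]
      map_smul' := fun z e => by
        rw [CStarModule.inner_smul_right_complex, smul_mul_assoc, smul_complex_smul,
          RingHom.id_apply] }
    (‖x‖ * ‖op b‖ * ‖x‖) fun e => by
      calc ‖(⟪x, e⟫_Bᵐᵒᵖ * op b) • x‖ ≤ ‖⟪x, e⟫_Bᵐᵒᵖ‖ * ‖op b‖ * ‖x‖ :=
            (norm_smul_le' _ _).trans (by gcongr; exact norm_mul_le _ _)
        _ ≤ (‖x‖ * ‖e‖) * ‖op b‖ * ‖x‖ := by gcongr; exact CStarModule.norm_inner_le E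
        _ = _ := by ring

theorem rankOneCLM_apply (x : E) (b : B) (e : E) :
    rankOneCLM x b e = (⟪x, e⟫_Bᵐᵒᵖ * op b) • x := rfl

theorem inner_rankOneCLM_left (x : E) (b : B) (e f : E) :
    ⟪rankOneCLM x b e, f⟫_Bᵐᵒᵖ = ⟪e, rankOneCLM x (star b) f⟫_Bᵐᵒᵖ := by
  rw [rankOneCLM_apply, rankOneCLM_apply, CStarModule.inner_op_smul_left,
    CStarModule.inner_op_smul_right, star_mul, CStarModule.star_inner, mul_assoc, ← op_star]

/-- For a unit vector `x`, the embedding `b ↦ (e ↦ x b ⟨x, e⟩)` of `B` as a corner of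
`B^a(E)`. -/
def rankOneHom (x : E) (hx : ⟪x, x⟫_Bᵐᵒᵖ = 1) : B →⋆ₙₐ[ℂ] Adjointable Bᵐᵒᵖ E where
  toFun b := ⟨rankOneCLM x b, rankOneCLM x (star b), inner_rankOneCLM_left x b⟩
  map_smul' z b := DFunLike.ext _ _ fun e => by
    change (⟪x, e⟫_Bᵐᵒᵖ * op (z • b)) • x = z • (⟪x, e⟫_Bᵐᵒᵖ * op b) • x
    rw [op_smul, mul_smul_comm, smul_complex_smul]
  map_zero' := DFunLike.ext _ _ fun e => by
    change (⟪x, e⟫_Bᵐᵒᵖ * op (0 : B)) • x = 0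
    rw [op_zero, mul_zero, zero_smul]
  map_add' b c := DFunLike.ext _ _ fun e => by
    change (⟪x, e⟫_Bᵐᵒᵖ * op (b + c)) • x = (⟪x, e⟫_Bᵐᵒᵖ * op b) • x + (⟪x, e⟫_Bᵐᵒᵖ * op c) • x
    rw [op_add, mul_add, add_smul]
  map_mul' b c := DFunLike.ext _ _ fun e => by
    change (⟪x, e⟫_Bᵐᵒᵖ * op (b * c)) • x =
      (⟪x, (⟪x, e⟫_Bᵐᵒᵖ * op c) • x⟫_Bᵐᵒᵖ * op b) • x
    rw [CStarModule.inner_op_smul_right, hx, mul_one, op_mul, mul_assoc]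
  map_star' b := Adjointable.eq_star_of_inner _ _ (inner_rankOneCLM_left x b)

theorem rankOneHom_apply (x : E) (hx : ⟪x, x⟫_Bᵐᵒᵖ = 1) (b : B) (e : E) :
    rankOneHom x hx b e = (⟪x, e⟫_Bᵐᵒᵖ * op b) • x := rfl

theorem rankOneHom_injective (x : E) (hx : ⟪x, x⟫_Bᵐᵒᵖ = 1) :
    Function.Injective (rankOneHom x hx) := fun b c h => by
  have := congrArg (fun T : Adjointable Bᵐᵒᵖ E => ⟪x, T x⟫_Bᵐᵒᵖ) h
  simpa only [rankOneHom_apply, hx, one_mul, CStarModule.inner_op_smul_right, mul_one,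
    op_inj] using this

/-- The image of `1` is the projection `p` onto `x B`, and `p T p` sends `e` to `x ⟨x, T x⟩ ⟨x, e⟩`.
-/
theorem rankOneHom_compression (x : E) (hx : ⟪x, x⟫_Bᵐᵒᵖ = 1) (T : Adjointable Bᵐᵒᵖ E) :
    rankOneHom x hx (unop ⟪x, T x⟫_Bᵐᵒᵖ) = rankOneHom x hx 1 * T * rankOneHom x hx 1 :=
  DFunLike.ext _ _ fun e => by
    simp only [Adjointable.mul_apply, rankOneHom_apply, op_unop, op_one, mul_one,
      Adjointable.map_smul, mul_smul]

/-- The corner embedding `θ` is isometric on matrices and turns the compression into `M ↦ P M P`,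
where `P` is the diagonal matrix with entries `θ 1`, of norm at most one. -/
theorem norm_compression_le [CompleteSpace E] (x : E) (hx : ⟪x, x⟫_Bᵐᵒᵖ = 1) {n : ℕ}
    (M : CStarMatrix (Fin n) (Fin n) (Adjointable Bᵐᵒᵖ E)) :
    ‖M.map fun T => unop ⟪x, T x⟫_Bᵐᵒᵖ‖ ≤ ‖M‖ := by
  set θ := rankOneHom (B := B) x hx
  set P : CStarMatrix (Fin n) (Fin n) (Adjointable Bᵐᵒᵖ E) := (1 : CStarMatrix _ _ B).map θ
  have hP : ‖P‖ ≤ 1 := (norm_map_starHom_le θ _).trans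
    (norm_one_le_one _)
  have key : (M.map fun T => unop ⟪x, T x⟫_Bᵐᵒᵖ).map θ = P * M * P := by
    ext i j
    simp only [P, CStarMatrix.map_apply, CStarMatrix.mul_apply, CStarMatrix.one_apply, apply_ite θ,
      map_zero, ite_mul, mul_ite, zero_mul, mul_zero, Finset.sum_ite_eq, Finset.sum_ite_eq',
      Finset.mem_univ, if_true]
    exact rankOneHom_compression x hx _
  rw [← norm_map_starHom_of_injective θ (rankOneHom_injective x hx), key]
  calc ‖P * M * P‖ ≤ ‖P‖ * ‖M‖ * ‖P‖ :=
        (norm_mul_le _ _).trans (by gcongr; exact norm_mul_le _ _)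
    _ ≤ 1 * ‖M‖ * 1 := by gcongr
    _ = ‖M‖ := by ring

theorem cbENorm_compression_le [CompleteSpace E] {A : Type*} [CStarAlgebra A] [PartialOrder A]
    [StarOrderedRing A] (x : E) (hx : ⟪x, x⟫_Bᵐᵒᵖ = 1) (f : A →ₗ[ℂ] Adjointable Bᵐᵒᵖ E)
    (g : A →ₗ[ℂ] B) (h : ∀ a, g a = unop ⟪x, f a x⟫_Bᵐᵒᵖ) : cbENorm g ≤ cbENorm f :=
  cbENorm_mono fun n M => by
    have : M.map g = (M.map f).map fun T => unop ⟪x, T x⟫_Bᵐᵒᵖ := by ext i j; exact h _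
    rw [this]
    exact norm_compression_le x hx _

end HilbertModule

/-! ## Positivity of Gram matrices -/

section Gram

variable {B : Type*} [CStarAlgebra B] [PartialOrder B] [StarOrderedRing B]

theorem CStarAlgebra.exists_nonneg_sub_of_isSelfAdjoint {D : Type*} [NonUnitalCStarAlgebra D]
    [PartialOrder D] [StarOrderedRing D] {a : D} (ha : IsSelfAdjoint a) :
    ∃ q p : D, 0 ≤ q ∧ 0 ≤ p ∧ q - p = a ∧ p * q = 0 :=
  ⟨a⁺, a⁻, CFC.posPart_nonneg a, CFC.negPart_nonneg a, CFC.posPart_sub_negPart a ha,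
    CFC.negPart_mul_posPart a⟩

theorem CStarAlgebra.exists_eq_star_mul_self_of_nonneg {D : Type*} [NonUnitalCStarAlgebra D]
    [PartialOrder D] [StarOrderedRing D] {a : D} (ha : 0 ≤ a) : ∃ c : D, a = star c * c :=
  CStarAlgebra.nonneg_iff_eq_star_mul_self.1 ha

theorem CStarMatrix.diag_nonneg {n : ℕ} {Q : CStarMatrix (Fin n) (Fin n) B} (hQ : 0 ≤ Q)
    (k : Fin n) : 0 ≤ Q k k := by
  obtain ⟨s, rfl⟩ := CStarAlgebra.exists_eq_star_mul_self_of_nonneg hQ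
  rw [CStarMatrix.mul_apply]
  exact Finset.sum_nonneg fun i _ => by
    rw [CStarMatrix.star_apply]
    exact star_mul_self_nonneg _

variable {E : Type*} [NormedAddCommGroup E] [NormedSpace ℂ E] [Module Bᵐᵒᵖ E] [CStarModule Bᵐᵒᵖ E]

open MulOpposite

/-- If `p` is the negative part of the Gram matrix `a`, then `p a p = -p³`. But `p a p` is again a
Gram matrix, so its diagonal is both nonnegative and nonpositive. The vectors it comes from
therefore vanish, which gives `p³ = 0` and hence `p = 0`. -/
theorem HilbertModule.gram_nonneg {n : ℕ} (e : Fin n → E) :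
    0 ≤ (CStarMatrix.ofMatrix fun i j => unop ⟪e i, e j⟫_Bᵐᵒᵖ :
      CStarMatrix (Fin n) (Fin n) B) := by
  set a : CStarMatrix (Fin n) (Fin n) B := CStarMatrix.ofMatrix fun i j => unop ⟪e i, e j⟫_Bᵐᵒᵖ
  have ha : IsSelfAdjoint a := CStarMatrix.ext fun i j => by
    rw [CStarMatrix.star_apply]
    exact congrArg unop (CStarModule.star_inner (A := Bᵐᵒᵖ) (e j) (e i))
  obtain ⟨q, p, hq0, hp0, hsub, hpq⟩ := CStarAlgebra.exists_nonneg_sub_of_isSelfAdjoint ha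
  have hp : star p = p := hp0.isSelfAdjoint
  have hmul : p * a * p = -(p * p * p) := by
    conv_lhs => rw [← hsub]
    rw [mul_sub, hpq, zero_sub, neg_mul]
  -- In right-module notation, `f l = ∑ e_j p_{jl}`.
  let f : Fin n → E := fun l => ∑ j, op (p j l) • e j
  have hpi (i j : Fin n) : star (p i j) = p j i := by
    conv_rhs => rw [← hp]
    rw [CStarMatrix.star_apply]
  have hf (k l : Fin n) : unop ⟪f k, f l⟫_Bᵐᵒᵖ = (p * a * p) k l := by
    simp only [f, CStarModule.inner_sum_left, CStarModule.inner_sum_right,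
      CStarModule.inner_op_smul_left, CStarModule.inner_op_smul_right, CStarMatrix.mul_apply,
      Finset.unop_sum, unop_mul, unop_op, ← op_star, hpi, Finset.sum_mul]
    rfl
  have hcube : 0 ≤ p * p * p := by
    simpa [hp] using star_left_conjugate_nonneg hp0 p
  have hf0 (k : Fin n) : f k = 0 := by
    refine (CStarModule.inner_self (A := Bᵐᵒᵖ)).1 ?_
    have h1 : 0 ≤ unop ⟪f k, f k⟫_Bᵐᵒᵖ := unop_nonneg.2 CStarModule.inner_self_nonneg
    have h2 : unop ⟪f k, f k⟫_Bᵐᵒᵖ ≤ 0 := by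
      rw [hf, hmul, CStarMatrix.neg_apply]
      exact neg_nonpos.2 (CStarMatrix.diag_nonneg hcube k)
    exact unop_injective (le_antisymm h2 h1)
  have hzero : p * p * p = 0 := by
    rw [← neg_eq_zero, ← hmul]
    ext k l
    rw [← hf, hf0]
    simp
  have hpp : p * p = 0 := by
    rw [← CStarRing.star_mul_self_eq_zero_iff, star_mul, hp, ← mul_assoc, hzero, zero_mul]
  have hp1 : p = 0 := by
    rw [← CStarRing.star_mul_self_eq_zero_iff, hp, hpp]
  rw [← hsub, hp1, sub_zero]
  exact hq0

end Gram

/-! ## Kolmogorov decompositions of operator-valued kernels -/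

section Kolmogorov

open scoped TensorProduct ComplexConjugate

/-- The form may be degenerate: completing the seminormed space also divides out the null vectors,
so `Λ` need not be injective. -/
theorem PreInnerProductSpace.Core.exists_completion {V : Type w} [AddCommGroup V] [Module ℂ V]
    (c : PreInnerProductSpace.Core ℂ V) :
    ∃ (H : Type w) (_ : NormedAddCommGroup H) (_ : InnerProductSpace ℂ H) (_ : CompleteSpace H)
      (Λ : V →ₗ[ℂ] H), DenseRange Λ ∧ ∀ x y, ⟪Λ x, Λ y⟫_ℂ = c.inner x y := by
  let : SeminormedAddCommGroup V := InnerProductSpace.Core.toSeminormedAddCommGroup (c := c)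
  let : InnerProductSpace ℂ V := InnerProductSpace.ofCore c
  refine ⟨UniformSpace.Completion V, inferInstance, inferInstance, inferInstance,
    (UniformSpace.Completion.toComplL (𝕜 := ℂ) (E := V)).toLinearMap,
    UniformSpace.Completion.denseRange_coe, fun x y => ?_⟩
  exact UniformSpace.Completion.inner_coe x y

variable {X : Type u} {B : Type*} {G : Type v} [AddCommGroup X] [Module ℂ X]
  [CStarAlgebra B] [NormedAddCommGroup G] [InnerProductSpace ℂ G] [CompleteSpace G]
  (j : B →⋆ₐ[ℂ] (G →L[ℂ] G)) (K : X →ₗ⋆[ℂ] X →ₗ[ℂ] B)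

/-- The sesquilinear form `⟨x ⊗ g, y ⊗ h⟩ = ⟨g, j (K x y) h⟩` on `X ⊗ G`. -/
def kernelForm : X ⊗[ℂ] G →ₗ⋆[ℂ] X ⊗[ℂ] G →ₗ[ℂ] ℂ :=
  TensorProduct.lift <| LinearMap.mk₂'ₛₗ (starRingEnd ℂ) (starRingEnd ℂ)
    (fun x g => TensorProduct.lift <| LinearMap.mk₂ ℂ (fun y h => ⟪g, j (K x y) h⟫_ℂ)
      (by intros; simp) (by intros; simp) (by intros; simp) (by intros; simp))
    (by intros; ext; simp) (by intros; ext; simp) (by intros; ext; simp)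
    (by intros; ext; simp [mul_comm])

@[simp]
theorem kernelForm_tmul (x y : X) (g h : G) :
    kernelForm j K (x ⊗ₜ g) (y ⊗ₜ h) = ⟪g, j (K x y) h⟫_ℂ := rfl

theorem kernelForm_conj_symm (hK : ∀ x y, star (K x y) = K y x) (s t : X ⊗[ℂ] G) :
    conj (kernelForm j K t s) = kernelForm j K s t := by
  induction s with
  | zero => simp
  | add a b ha hb => simp [ha, hb]
  | tmul x g =>
    induction t with
    | zero => simp
    | add a b ha hb => simp [ha, hb]
    | tmul y h =>
      rw [kernelForm_tmul, kernelForm_tmul, inner_conj_symm, ← hK, map_star,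
        ContinuousLinearMap.star_eq_adjoint, ContinuousLinearMap.adjoint_inner_left]

variable [PartialOrder B] [StarOrderedRing B]

/-- Factoring the positive matrix `[K (e i) (e k)]` as `c⋆ c` turns the form into the sum over `l`
of `‖∑ i, j (c l i) (g i)‖²`. -/
theorem kernelForm_self_re_nonneg
    (hpos : ∀ (n : ℕ) (e : Fin n → X), 0 ≤ (CStarMatrix.ofMatrix fun i k => K (e i) (e k) :
      CStarMatrix (Fin n) (Fin n) B)) (t : X ⊗[ℂ] G) :
    0 ≤ (kernelForm j K t t).re := by
  obtain ⟨n, e, g, rfl⟩ := TensorProduct.exists_sum_tmul_eq t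
  obtain ⟨c, hc⟩ := CStarAlgebra.exists_eq_star_mul_self_of_nonneg (hpos n e)
  have hKc (i k : Fin n) : K (e i) (e k) = ∑ l, star (c l i) * c l k := by
    have := CStarMatrix.ext_iff.2 hc i k
    rw [CStarMatrix.mul_apply] at this
    exact this
  have key : kernelForm j K (∑ i, e i ⊗ₜ g i) (∑ i, e i ⊗ₜ g i) =
      ∑ l, ⟪∑ i, j (c l i) (g i), ∑ i, j (c l i) (g i)⟫_ℂ := by
    simp only [map_sum, LinearMap.sum_apply, kernelForm_tmul, hKc, map_mul, map_star,
      sum_apply, mul_apply_eq_comp, inner_sum, sum_inner,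
      ContinuousLinearMap.star_eq_adjoint, ContinuousLinearMap.adjoint_inner_right]
    conv_rhs => rw [Finset.sum_comm]
    exact Finset.sum_congr rfl fun i _ => Finset.sum_comm
  rw [key, Complex.re_sum]
  exact Finset.sum_nonneg fun l _ => inner_self_nonneg (𝕜 := ℂ)

theorem exists_kolmogorov (hK : ∀ x y, star (K x y) = K y x)
    (hpos : ∀ (n : ℕ) (e : Fin n → X), 0 ≤ (CStarMatrix.ofMatrix fun i k => K (e i) (e k) :
      CStarMatrix (Fin n) (Fin n) B)) :
    ∃ (H : Type (max u v)) (_ : NormedAddCommGroup H) (_ : InnerProductSpace ℂ H) (_ : CompleteSpace H)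
      (Λ : X ⊗[ℂ] G →ₗ[ℂ] H), DenseRange Λ ∧
        ∀ x y g h, ⟪Λ (x ⊗ₜ g), Λ (y ⊗ₜ h)⟫_ℂ = ⟪g, j (K x y) h⟫_ℂ := by
  obtain ⟨H, i1, i2, i3, Λ, hΛ, h⟩ := PreInnerProductSpace.Core.exists_completion
    { inner := fun s t => kernelForm j K s t
      conj_inner_symm := fun s t => kernelForm_conj_symm j K hK s t
      re_inner_nonneg := fun t => kernelForm_self_re_nonneg j K hpos t
      add_left := fun s t r => by simp
      smul_left := fun s t z => by simp }
  exact ⟨H, i1, i2, i3, Λ, hΛ, fun x y g k => h _ _⟩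

end Kolmogorov

/-! ### Extending isometries and representations from a dense subspace -/

section Extension

variable {V H H' : Type*} [AddCommGroup V] [Module ℂ V]
  [NormedAddCommGroup H] [InnerProductSpace ℂ H]
  [NormedAddCommGroup H'] [InnerProductSpace ℂ H']

theorem ext_of_denseRange {Λ : V →ₗ[ℂ] H} (hΛ : DenseRange Λ) {S T : H →L[ℂ] H'}
    (h : ∀ x, S (Λ x) = T (Λ x)) : S = T :=
  DFunLike.coe_injective (hΛ.equalizer S.continuous T.continuous (funext h))

/-- An inner product preserving map on a dense subspace extends to an isometry. -/
theorem exists_isometry_extension [CompleteSpace H] [CompleteSpace H'] {Λ : V →ₗ[ℂ] H}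
    (hΛ : DenseRange Λ) (f : V →ₗ[ℂ] H') (hf : ∀ x y, ⟪f x, f y⟫_ℂ = ⟪Λ x, Λ y⟫_ℂ) :
    ∃ F : H →L[ℂ] H', (∀ x, F (Λ x) = f x) ∧ F.adjoint ∘L F = 1 := by
  have hn (x) : ‖f x‖ ≤ 1 * ‖Λ x‖ := by
    rw [one_mul, @norm_eq_sqrt_re_inner ℂ, @norm_eq_sqrt_re_inner ℂ, hf]
  have hF := LinearMap.extendOfNorm_eq hΛ ⟨1, hn⟩ (f := f)
  refine ⟨f.extendOfNorm Λ, hF, ?_⟩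
  refine ext_of_denseRange hΛ fun x => ?_
  refine ext_inner_left ℂ fun y => ?_
  refine hΛ.induction_on y (isClosed_eq (by fun_prop) (by fun_prop)) fun y => ?_
  simp [ContinuousLinearMap.adjoint_inner_right, hF, hf]

/-- A `⋆`-representation of a C⋆-algebra on a pre-Hilbert space extends to the completion. -/
theorem exists_starAlgHom_extension [CompleteSpace H] {D : Type*} [CStarAlgebra D]
    {Λ : V →ₗ[ℂ] H} (hΛ : DenseRange Λ)
    (π : D →ₐ[ℂ] Module.End ℂ V)
    (hπ : ∀ d x y, ⟪Λ (π d x), Λ y⟫_ℂ = ⟪Λ x, Λ (π (star d) y)⟫_ℂ) :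
    ∃ π' : D →⋆ₐ[ℂ] (H →L[ℂ] H), ∀ d x, π' d (Λ x) = Λ (π d x) := by
  let := CStarAlgebra.spectralOrder D
  have := CStarAlgebra.spectralOrderedRing D
  have hbound (d x) : ‖Λ (π d x)‖ ≤ ‖d‖ * ‖Λ x‖ := by
    -- Boundedness is automatic: with `‖d‖² - d⋆d = c⋆c`, the number `⟪Λ x, Λ (π (c⋆c) x)⟫ = ‖Λ (π c
    -- x)‖²` is nonnegative, that is, `‖Λ (π d x)‖² ≤ ‖d‖² ‖Λ x‖²`.
    obtain ⟨c, hc⟩ := CStarAlgebra.exists_eq_star_mul_self_of_nonneg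
      (sub_nonneg.2 (CStarAlgebra.star_mul_le_algebraMap_norm_sq (a := d)))
    have h1 : ⟪Λ x, Λ (π (star c * c) x)⟫_ℂ = (‖Λ (π c x)‖ : ℂ) ^ 2 := by
      rw [map_mul, Module.End.mul_apply, ← hπ, inner_self_eq_norm_sq_to_K]; rfl
    have h2 : ⟪Λ x, Λ (π (star d * d) x)⟫_ℂ = (‖Λ (π d x)‖ : ℂ) ^ 2 := by
      rw [map_mul, Module.End.mul_apply, ← hπ, inner_self_eq_norm_sq_to_K]; rfl
    have h3 : ⟪Λ x, Λ (π (algebraMap ℝ D (‖d‖ ^ 2)) x)⟫_ℂ = (‖d‖ : ℂ) ^ 2 * (‖Λ x‖ : ℂ) ^ 2 := by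
      rw [IsScalarTower.algebraMap_apply ℝ ℂ D, AlgHom.commutes, Module.algebraMap_end_apply,
        map_smul, inner_smul_right, inner_self_eq_norm_sq_to_K]
      simp
    rw [← hc, map_sub, LinearMap.sub_apply, map_sub, inner_sub_right, h2, h3] at h1
    norm_cast at h1
    refine (sq_le_sq₀ (norm_nonneg _) (by positivity)).1 ?_
    nlinarith [sq_nonneg ‖Λ (π c x)‖]
  obtain ⟨P, hP⟩ : ∃ P : D → H →L[ℂ] H, ∀ d x, P d (Λ x) = Λ (π d x) :=
    ⟨fun d => (Λ ∘ₗ π d).extendOfNorm Λ,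
      fun d => LinearMap.extendOfNorm_eq hΛ ⟨‖d‖, hbound d⟩ (f := Λ ∘ₗ π d)⟩
  refine ⟨{ toFun := P
            map_one' := ext_of_denseRange hΛ fun x => by simp [hP]
            map_zero' := ext_of_denseRange hΛ fun x => by simp [hP]
            map_mul' := fun a b => ext_of_denseRange hΛ fun x => by simp [hP]
            map_add' := fun a b => ext_of_denseRange hΛ fun x => by simp [hP]
            commutes' := fun z => ext_of_denseRange hΛ fun x => by
              rw [hP, AlgHom.commutes]; simp [Algebra.algebraMap_eq_smul_one]
            map_star' := fun d => ?_ }, hP⟩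
  rw [ContinuousLinearMap.star_eq_adjoint, ContinuousLinearMap.eq_adjoint_iff]
  intro x y
  refine hΛ.induction_on x (isClosed_eq (by fun_prop) (by fun_prop)) fun x => ?_
  refine hΛ.induction_on y (isClosed_eq (by fun_prop) (by fun_prop)) fun y => ?_
  rw [hP, hP, hπ, star_star]

end Extension

/-! ### Kolmogorov spaces with two commuting actions -/

section Correspondence

open scoped TensorProduct

/-- A positive `2 × 2` matrix is selfadjoint; compare its off-diagonal entries. -/
theorem kernel_conj_symm_of_nonneg {X B : Type*} [AddCommGroup X] [Module ℂ X] [CStarAlgebra B]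
    [PartialOrder B] [StarOrderedRing B] (K : X →ₗ⋆[ℂ] X →ₗ[ℂ] B)
    (hpos : ∀ (n : ℕ) (e : Fin n → X), 0 ≤ (CStarMatrix.ofMatrix fun i k => K (e i) (e k) :
      CStarMatrix (Fin n) (Fin n) B)) (x y : X) : star (K x y) = K y x :=
  CStarMatrix.ext_iff.2 (hpos 2 ![x, y]).isSelfAdjoint 1 0

/-- A Kolmogorov decomposition with a left action by `π` and an action `ρ` of operators commuting
with the values of the kernel. -/
theorem exists_correspondence {X : Type u} {B N D : Type*} {G : Type v} [AddCommGroup X]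
    [Module ℂ X] [CStarAlgebra B] [PartialOrder B] [StarOrderedRing B]
    [CStarAlgebra N] [CStarAlgebra D]
    [NormedAddCommGroup G] [InnerProductSpace ℂ G] [CompleteSpace G]
    (j : B →⋆ₐ[ℂ] (G →L[ℂ] G)) (r : N →⋆ₐ[ℂ] (G →L[ℂ] G)) (hjr : ∀ n b, Commute (r n) (j b))
    (K : X →ₗ⋆[ℂ] X →ₗ[ℂ] B)
    (hpos : ∀ (n : ℕ) (e : Fin n → X), 0 ≤ (CStarMatrix.ofMatrix fun i k => K (e i) (e k) :
      CStarMatrix (Fin n) (Fin n) B))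
    (πX : D →ₐ[ℂ] Module.End ℂ X) (hπX : ∀ d x y, K (πX d x) y = K x (πX (star d) y)) :
    ∃ (H : Type (max u v)) (_ : NormedAddCommGroup H) (_ : InnerProductSpace ℂ H)
      (_ : CompleteSpace H) (Λ : X ⊗[ℂ] G →ₗ[ℂ] H) (π : D →⋆ₐ[ℂ] (H →L[ℂ] H))
      (ρ : N →⋆ₐ[ℂ] (H →L[ℂ] H)), DenseRange Λ ∧
        (∀ x y g h, ⟪Λ (x ⊗ₜ g), Λ (y ⊗ₜ h)⟫_ℂ = ⟪g, j (K x y) h⟫_ℂ) ∧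
        (∀ d x g, π d (Λ (x ⊗ₜ g)) = Λ (πX d x ⊗ₜ g)) ∧
        (∀ n x g, ρ n (Λ (x ⊗ₜ g)) = Λ (x ⊗ₜ r n g)) ∧ ∀ d n, Commute (π d) (ρ n) := by
  obtain ⟨H, i1, i2, i3, Λ, hΛ, hin⟩ :=
    exists_kolmogorov j K (kernel_conj_symm_of_nonneg K hpos) hpos
  let tD : D →ₐ[ℂ] Module.End ℂ (X ⊗[ℂ] G) :=
    AlgHom.ofLinearMap (LinearMap.rTensorHom G ∘ₗ πX.toLinearMap)
      (TensorProduct.ext' fun x g => by simp)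
      fun a b => TensorProduct.ext' fun x g => by simp
  let tN : N →ₐ[ℂ] Module.End ℂ (X ⊗[ℂ] G) :=
    AlgHom.ofLinearMap (LinearMap.lTensorHom X ∘ₗ (ContinuousLinearMap.coeLM ℂ) ∘ₗ
        r.toAlgHom.toLinearMap)
      (TensorProduct.ext' fun x g => by simp)
      fun a b => TensorProduct.ext' fun x g => by simp
  have htD (d x g) : tD d (x ⊗ₜ g) = πX d x ⊗ₜ g := rfl
  have htN (n x g) : tN n (x ⊗ₜ g) = x ⊗ₜ r n g := rfl
  obtain ⟨π, hπ⟩ := exists_starAlgHom_extension hΛ tD fun d s t => by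
    induction s with
    | zero => simp
    | add a b ha hb => simp only [map_add, inner_add_left, ha, hb]
    | tmul x g =>
      induction t with
      | zero => simp
      | add a b ha hb => simp only [map_add, inner_add_right, ha, hb]
      | tmul y h => rw [htD, htD, hin, hin, hπX]
  obtain ⟨ρ, hρ⟩ := exists_starAlgHom_extension hΛ tN fun d s t => by
    induction s with
    | zero => simp
    | add a b ha hb => simp only [map_add, inner_add_left, ha, hb]
    | tmul x g =>
      induction t with
      | zero => simp
      | add a b ha hb => simp only [map_add, inner_add_right, ha, hb]
      | tmul y h =>
        rw [htN, htN, hin, hin, map_star, ContinuousLinearMap.star_eq_adjoint,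
          ← ContinuousLinearMap.adjoint_inner_right, ← ContinuousLinearMap.star_eq_adjoint,
          ← map_star]
        -- Acting by `r n` on the second factor respects adjoints exactly because `r n` commutes
        -- with the values of `j ∘ K`.
        exact congrArg (fun T : G →L[ℂ] G => ⟪g, T h⟫_ℂ) (hjr (star d) (K x y)).eq
  refine ⟨H, i1, i2, i3, Λ, π, ρ, hΛ, hin, fun d x g => hπ _ _, fun n x g => hρ _ _,
    fun d n => ext_of_denseRange hΛ fun t => ?_⟩
  rw [mul_apply_eq_comp, mul_apply_eq_comp, hρ, hπ, hπ, hρ]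
  congr 1
  induction t with
  | zero => simp
  | add a b ha hb => simp only [map_add, ha, hb]
  | tmul x g => rw [htN, htD, htD, htN]

end Correspondence

/-- For `p` the negative part of `c`, the element `j (p c p) = -j (p³)` is both positive and
negative, so injectivity kills `p³` and hence `p`. This brings positivity of `T⋆T` from operators on
`G` back to `B`. -/
theorem NonUnitalStarAlgHom.nonneg_of_injective {B D : Type*} [NonUnitalCStarAlgebra B]
    [PartialOrder B] [StarOrderedRing B] [NonUnitalCStarAlgebra D] [PartialOrder D]
    [StarOrderedRing D] (j : B →⋆ₙₐ[ℂ] D) (hj : Function.Injective j) {c : B} (hc : 0 ≤ j c) :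
    0 ≤ c := by
  have hsa : IsSelfAdjoint c := hj (by rw [map_star]; exact hc.isSelfAdjoint)
  obtain ⟨q, p, hq0, hp0, hsub, hpq⟩ := CStarAlgebra.exists_nonneg_sub_of_isSelfAdjoint hsa
  have hp : star p = p := hp0.isSelfAdjoint
  have hmul : p * c * p = -(p * p * p) := by
    rw [← hsub, mul_sub, hpq, zero_sub, neg_mul]
  have h1 : 0 ≤ j (p * c * p) := by
    rw [map_mul, map_mul]
    nth_rewrite 1 [← hp]
    rw [map_star]
    exact star_left_conjugate_nonneg hc (j p)
  have h2 : 0 ≤ j (p * p * p) := by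
    refine map_nonneg j ?_
    simpa [hp] using star_left_conjugate_nonneg hp0 p
  have h3 : p * p * p = 0 := by
    refine hj ?_
    rw [map_zero]
    rw [hmul, map_neg] at h1
    exact le_antisymm (neg_nonneg.1 h1) h2
  have hpp : p * p = 0 := by
    rw [← CStarRing.star_mul_self_eq_zero_iff, star_mul, hp, ← mul_assoc, h3, zero_mul]
  have hp1 : p = 0 := by
    rw [← CStarRing.star_mul_self_eq_zero_iff, hp, hpp]
  rw [← hsub, hp1, sub_zero]
  exact hq0

/-! ## Hilbert modules of intertwiners -/

theorem StarAlgHom.adjoint_apply {D H : Type*} [CStarAlgebra D] [NormedAddCommGroup H]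
    [InnerProductSpace ℂ H] [CompleteSpace H] (σ : D →⋆ₐ[ℂ] (H →L[ℂ] H)) (d : D) :
    (σ d).adjoint = σ (star d) :=
  (map_star σ d).symm

theorem StarAlgHom.adjoint_comp_eq_of_comp_eq {D H K : Type*} [CStarAlgebra D]
    [NormedAddCommGroup H] [InnerProductSpace ℂ H] [CompleteSpace H]
    [NormedAddCommGroup K] [InnerProductSpace ℂ K] [CompleteSpace K]
    {κ : D →⋆ₐ[ℂ] (K →L[ℂ] K)} {σ : D →⋆ₐ[ℂ] (H →L[ℂ] H)} {V : K →L[ℂ] H}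
    (hV : ∀ d, V ∘L κ d = σ d ∘L V) (d : D) : V.adjoint ∘L σ d = κ d ∘L V.adjoint := by
  have := congrArg ContinuousLinearMap.adjoint (hV (star d))
  rw [ContinuousLinearMap.adjoint_comp, ContinuousLinearMap.adjoint_comp, StarAlgHom.adjoint_apply,
    StarAlgHom.adjoint_apply, star_star] at this
  exact this.symm

section Intertwiner

open MulOpposite

variable {B N G H : Type*} [CStarAlgebra B] [CStarAlgebra N]
  [NormedAddCommGroup G] [InnerProductSpace ℂ G] [CompleteSpace G]
  [NormedAddCommGroup H] [InnerProductSpace ℂ H] [CompleteSpace H]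

/-- `j` identifies `B` with the commutant of the range of `r`. -/
structure IsCommutantOf (j : B →⋆ₐ[ℂ] (G →L[ℂ] G)) (r : N →⋆ₐ[ℂ] (G →L[ℂ] G)) : Prop where
  injective : Function.Injective j
  commute : ∀ n b, Commute (r n) (j b)
  exists_eq : ∀ T, (∀ n, Commute (r n) T) → ∃ b, j b = T

variable {j : B →⋆ₐ[ℂ] (G →L[ℂ] G)} {r : N →⋆ₐ[ℂ] (G →L[ℂ] G)}

variable (r) in
/-- The operators `G → H` intertwining two actions of `N`. -/
def intertwinerSubmodule (ρ : N →⋆ₐ[ℂ] (H →L[ℂ] H)) : Submodule ℂ (G →L[ℂ] H) where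
  carrier := {T | ∀ n, T ∘L r n = ρ n ∘L T}
  zero_mem' n := by simp
  add_mem' {S T} hS hT n := by rw [ContinuousLinearMap.add_comp, hS n, hT n,
    ContinuousLinearMap.comp_add]
  smul_mem' z T hT n := by rw [ContinuousLinearMap.smul_comp, hT n,
    ContinuousLinearMap.comp_smul]

theorem isClosed_intertwinerSubmodule (ρ : N →⋆ₐ[ℂ] (H →L[ℂ] H)) :
    IsClosed (intertwinerSubmodule r ρ : Set (G →L[ℂ] H)) := by
  have : (intertwinerSubmodule r ρ : Set (G →L[ℂ] H)) =
      ⋂ n, {T : G →L[ℂ] H | T ∘L r n = ρ n ∘L T} := by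
    ext T
    simp [intertwinerSubmodule]
  rw [this]
  exact isClosed_iInter fun n => isClosed_eq
    (continuous_id.clm_comp continuous_const) (continuous_const.clm_comp continuous_id)

/-- The intertwiners `G → H`, as a Hilbert module over the commutant `B` of `N`. -/
def Intertwiner (_h : IsCommutantOf j r) (ρ : N →⋆ₐ[ℂ] (H →L[ℂ] H)) : Type _ :=
  ↥(intertwinerSubmodule r ρ)

namespace Intertwiner

variable (h : IsCommutantOf j r) (ρ : N →⋆ₐ[ℂ] (H →L[ℂ] H))

instance : NormedAddCommGroup (Intertwiner h ρ) :=
  inferInstanceAs (NormedAddCommGroup ↥(intertwinerSubmodule r ρ))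

instance : NormedSpace ℂ (Intertwiner h ρ) :=
  inferInstanceAs (NormedSpace ℂ ↥(intertwinerSubmodule r ρ))

instance : CompleteSpace (Intertwiner h ρ) :=
  (isClosed_intertwinerSubmodule (r := r) ρ).completeSpace_coe

variable {h ρ}

/-- The underlying operator of an intertwiner. -/
def toCLM (T : Intertwiner h ρ) : G →L[ℂ] H := T.1

/-- An intertwining operator as an element of the module. -/
def ofCLM (T : G →L[ℂ] H) (hT : ∀ n, T ∘L r n = ρ n ∘L T) : Intertwiner h ρ := ⟨T, hT⟩

theorem toCLM_ofCLM (T : G →L[ℂ] H) (hT : ∀ n, T ∘L r n = ρ n ∘L T) :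
    (ofCLM T hT : Intertwiner h ρ).toCLM = T := rfl

theorem ext' {S T : Intertwiner h ρ} (hST : S.toCLM = T.toCLM) : S = T := Subtype.ext hST

theorem toCLM_comp (T : Intertwiner h ρ) (n : N) : T.toCLM ∘L r n = ρ n ∘L T.toCLM := T.2 n

theorem toCLM_add (S T : Intertwiner h ρ) : (S + T).toCLM = S.toCLM + T.toCLM := rfl

theorem toCLM_smul (z : ℂ) (T : Intertwiner h ρ) : (z • T).toCLM = z • T.toCLM := rfl

theorem norm_toCLM (T : Intertwiner h ρ) : ‖T.toCLM‖ = ‖T‖ := rfl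

theorem adjoint_comp (T : Intertwiner h ρ) (n : N) :
    T.toCLM.adjoint ∘L ρ n = r n ∘L T.toCLM.adjoint :=
  StarAlgHom.adjoint_comp_eq_of_comp_eq T.toCLM_comp n

/-- The bicommutant property enters here: `S⋆T` commutes with the range of `r`, so it comes from
`B`. For a general C⋆-algebra the inner product would leave `B`. -/
theorem exists_coeff (S T : Intertwiner h ρ) : ∃ b, j b = S.toCLM.adjoint ∘L T.toCLM :=
  h.exists_eq _ fun n => by
    change r n ∘L (S.toCLM.adjoint ∘L T.toCLM) = (S.toCLM.adjoint ∘L T.toCLM) ∘L r n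
    rw [← ContinuousLinearMap.comp_assoc, ← adjoint_comp, ContinuousLinearMap.comp_assoc,
      ContinuousLinearMap.comp_assoc, toCLM_comp]

/-- The `B`-valued inner product `S⋆ T` of two intertwiners. -/
def coeff (S T : Intertwiner h ρ) : B := (exists_coeff S T).choose

theorem map_coeff (S T : Intertwiner h ρ) : j (coeff S T) = S.toCLM.adjoint ∘L T.toCLM :=
  (exists_coeff S T).choose_spec

instance : SMul Bᵐᵒᵖ (Intertwiner h ρ) where
  smul b T := ⟨T.toCLM ∘L j (unop b), fun n => by
    rw [ContinuousLinearMap.comp_assoc, ← ContinuousLinearMap.mul_def, ← (h.commute n _).eq,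
      ContinuousLinearMap.mul_def, ← ContinuousLinearMap.comp_assoc, toCLM_comp,
      ContinuousLinearMap.comp_assoc]⟩

theorem toCLM_op_smul (b : Bᵐᵒᵖ) (T : Intertwiner h ρ) :
    (b • T).toCLM = T.toCLM ∘L j (unop b) := rfl

instance : Module Bᵐᵒᵖ (Intertwiner h ρ) where
  one_smul T := ext' <| by
    rw [toCLM_op_smul, unop_one, map_one]
    rfl
  mul_smul b c T := ext' <| by
    rw [toCLM_op_smul, toCLM_op_smul, toCLM_op_smul, unop_mul, map_mul]
    rfl
  smul_zero b := ext' <| ContinuousLinearMap.zero_comp _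
  smul_add b S T := ext' <| ContinuousLinearMap.add_comp _ _ _
  add_smul b c T := ext' <| by
    rw [toCLM_add, toCLM_op_smul, toCLM_op_smul, toCLM_op_smul, unop_add, map_add,
      ContinuousLinearMap.comp_add]
  zero_smul T := ext' <| by
    rw [toCLM_op_smul, unop_zero, map_zero, ContinuousLinearMap.comp_zero]
    rfl

section Inner

variable [PartialOrder B] [StarOrderedRing B]

instance : CStarModule Bᵐᵒᵖ (Intertwiner h ρ) where
  inner S T := op (coeff S T)
  inner_add_right {S T U} := unop_injective <| h.injective <| by
    rw [unop_add, unop_op, unop_op, unop_op, map_add, map_coeff, map_coeff, map_coeff, toCLM_add,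
      ContinuousLinearMap.comp_add]
  inner_self_nonneg {T} := op_nonneg.2 <|
    NonUnitalStarAlgHom.nonneg_of_injective (j : B →⋆ₙₐ[ℂ] (G →L[ℂ] G)) h.injective <| by
      change 0 ≤ j (coeff T T)
      rw [map_coeff, ContinuousLinearMap.nonneg_iff_isPositive]
      exact ContinuousLinearMap.isPositive_adjoint_comp_self _
  inner_self {T} := by
    rw [op_eq_zero_iff, ← map_eq_zero_iff j h.injective, map_coeff, ← norm_eq_zero,
      ContinuousLinearMap.norm_adjoint_comp_self, mul_self_eq_zero, norm_toCLM, norm_eq_zero]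
  inner_op_smul_right {b S T} := unop_injective <| h.injective <| by
    rw [unop_mul, unop_op, unop_op, map_mul, map_coeff, map_coeff, toCLM_op_smul]
    rfl
  inner_smul_right_complex {z S T} := unop_injective <| h.injective <| by
    rw [unop_smul, unop_op, unop_op, map_smul, map_coeff, map_coeff, toCLM_smul,
      ContinuousLinearMap.comp_smul]
  star_inner S T := unop_injective <| h.injective <| by
    rw [unop_star, unop_op, unop_op, map_star, map_coeff, map_coeff,
      ContinuousLinearMap.star_eq_adjoint, ContinuousLinearMap.adjoint_comp,
      ContinuousLinearMap.adjoint_adjoint]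
  norm_eq_sqrt_norm_inner_self T := by
    rw [norm_op, ← NonUnitalStarAlgHom.norm_map j h.injective, map_coeff,
      ContinuousLinearMap.norm_adjoint_comp_self, norm_toCLM, Real.sqrt_mul_self (norm_nonneg _)]

theorem inner_def (S T : Intertwiner h ρ) : ⟪S, T⟫_Bᵐᵒᵖ = op (coeff S T) := rfl

end Inner

variable (h ρ)

/-- Composition with an operator commuting with `ρ`. -/
def compCLM (T : StarSubalgebra.centralizer ℂ (Set.range ρ)) :
    Intertwiner h ρ →L[ℂ] Intertwiner h ρ :=
  LinearMap.mkContinuous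
    { toFun := fun S => ⟨T.1 ∘L S.toCLM, fun n => by
        have := (StarSubalgebra.mem_centralizer_iff ℂ).1 T.2 (ρ n) ⟨n, rfl⟩
        rw [ContinuousLinearMap.comp_assoc, toCLM_comp, ← ContinuousLinearMap.comp_assoc,
          ← ContinuousLinearMap.mul_def, ← this.1]
        rfl⟩
      map_add' := fun S S' => ext' (ContinuousLinearMap.comp_add _ _ _)
      map_smul' := fun z S => ext' (ContinuousLinearMap.comp_smul _ _ _) }
    ‖T.1‖ fun S => ContinuousLinearMap.opNorm_comp_le _ _

theorem toCLM_compCLM (T : StarSubalgebra.centralizer ℂ (Set.range ρ)) (S : Intertwiner h ρ) :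
    (compCLM h ρ T S).toCLM = T.1 ∘L S.toCLM := rfl

variable [PartialOrder B] [StarOrderedRing B]

theorem inner_compCLM_left (T : StarSubalgebra.centralizer ℂ (Set.range ρ))
    (S S' : Intertwiner h ρ) :
    ⟪compCLM h ρ T S, S'⟫_Bᵐᵒᵖ = ⟪S, compCLM h ρ (star T) S'⟫_Bᵐᵒᵖ :=
  unop_injective <| h.injective <| by
    rw [inner_def, inner_def, unop_op, unop_op, map_coeff, map_coeff, toCLM_compCLM,
      toCLM_compCLM, ContinuousLinearMap.adjoint_comp]
    rfl

/-- The commutant of `ρ` acts on the intertwiners by adjointable operators. -/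
def compHom : StarSubalgebra.centralizer ℂ (Set.range ρ) →⋆ₐ[ℂ]
    HilbertModule.Adjointable Bᵐᵒᵖ (Intertwiner h ρ) where
  toFun T := ⟨compCLM h ρ T, compCLM h ρ (star T), inner_compCLM_left h ρ T⟩
  map_one' := rfl
  map_mul' _ _ := rfl
  map_zero' := DFunLike.ext _ _ fun _ => ext' (ContinuousLinearMap.zero_comp _)
  map_add' _ _ := DFunLike.ext _ _ fun _ => ext' (ContinuousLinearMap.add_comp _ _ _)
  commutes' _ := rfl
  map_star' T := HilbertModule.Adjointable.eq_star_of_inner _ _ (inner_compCLM_left h ρ T)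

end Intertwiner

end Intertwiner

/-! ## Direct sums of Hilbert spaces -/

section DirectSum

variable {H₁ H₂ K : Type*} [NormedAddCommGroup H₁] [InnerProductSpace ℂ H₁] [CompleteSpace H₁]
  [NormedAddCommGroup H₂] [InnerProductSpace ℂ H₂] [CompleteSpace H₂]
  [NormedAddCommGroup K] [InnerProductSpace ℂ K] [CompleteSpace K]

/-- The Hilbert space direct sum `H₁ ⊕ H₂`. -/
def HilbertSum (H₁ H₂ : Type*) : Type _ := WithLp 2 (H₁ × H₂)

namespace HilbertSum

instance : NormedAddCommGroup (HilbertSum H₁ H₂) :=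
  inferInstanceAs (NormedAddCommGroup (WithLp 2 (H₁ × H₂)))

instance : InnerProductSpace ℂ (HilbertSum H₁ H₂) :=
  inferInstanceAs (InnerProductSpace ℂ (WithLp 2 (H₁ × H₂)))

instance : CompleteSpace (HilbertSum H₁ H₂) :=
  inferInstanceAs (CompleteSpace (WithLp 2 (H₁ × H₂)))

variable (H₁ H₂) in
/-- The Hilbert space direct sum as a product. -/
def equivProd : HilbertSum H₁ H₂ ≃L[ℂ] H₁ × H₂ := WithLp.prodContinuousLinearEquiv 2 ℂ H₁ H₂

/-- The first component. -/
def fst (x : HilbertSum H₁ H₂) : H₁ := (equivProd H₁ H₂ x).1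

/-- The second component. -/
def snd (x : HilbertSum H₁ H₂) : H₂ := (equivProd H₁ H₂ x).2

/-- The vector with given components. -/
def mk (x : H₁) (y : H₂) : HilbertSum H₁ H₂ := (equivProd H₁ H₂).symm (x, y)

@[simp] theorem fst_mk (x : H₁) (y : H₂) : (mk x y).fst = x := rfl

@[simp] theorem snd_mk (x : H₁) (y : H₂) : (mk x y).snd = y := rfl

@[simp] theorem fst_add (x y : HilbertSum H₁ H₂) : (x + y).fst = x.fst + y.fst := rfl

@[simp] theorem snd_add (x y : HilbertSum H₁ H₂) : (x + y).snd = x.snd + y.snd := rfl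

@[simp] theorem fst_sub (x y : HilbertSum H₁ H₂) : (x - y).fst = x.fst - y.fst := rfl

@[simp] theorem snd_sub (x y : HilbertSum H₁ H₂) : (x - y).snd = x.snd - y.snd := rfl

theorem inner_def (x y : HilbertSum H₁ H₂) :
    ⟪x, y⟫_ℂ = ⟪x.fst, y.fst⟫_ℂ + ⟪x.snd, y.snd⟫_ℂ := rfl

theorem ext' {x y : HilbertSum H₁ H₂} (h₁ : x.fst = y.fst) (h₂ : x.snd = y.snd) : x = y :=
  (equivProd H₁ H₂).injective (Prod.ext h₁ h₂)

end HilbertSum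

open HilbertSum

variable (H₁ H₂) in
/-- Block diagonal operators on `H₁ ⊕ H₂`. -/
def directSumHom : (H₁ →L[ℂ] H₁) × (H₂ →L[ℂ] H₂) →⋆ₐ[ℂ]
    (HilbertSum H₁ H₂ →L[ℂ] HilbertSum H₁ H₂) where
  toFun T := (equivProd H₁ H₂).symm.toContinuousLinearMap ∘L
    (T.1.prodMap T.2) ∘L (equivProd H₁ H₂).toContinuousLinearMap
  map_one' := rfl
  map_mul' _ _ := rfl
  map_zero' := rfl
  map_add' _ _ := rfl
  commutes' _ := rfl
  map_star' T := by
    rw [ContinuousLinearMap.star_eq_adjoint, ContinuousLinearMap.eq_adjoint_iff]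
    intro x y
    change ⟪(T.1.adjoint x.fst : H₁), y.fst⟫_ℂ + ⟪(T.2.adjoint x.snd : H₂), y.snd⟫_ℂ =
      ⟪x.fst, T.1 y.fst⟫_ℂ + ⟪x.snd, T.2 y.snd⟫_ℂ
    rw [ContinuousLinearMap.adjoint_inner_left, ContinuousLinearMap.adjoint_inner_left]

theorem directSumHom_apply (T : (H₁ →L[ℂ] H₁) × (H₂ →L[ℂ] H₂)) (x : HilbertSum H₁ H₂) :
    directSumHom H₁ H₂ T x = mk (T.1 x.fst) (T.2 x.snd) := rfl

variable (H₁ H₂) in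
/-- The inclusion of the first summand. -/
def inlL2 : H₁ →L[ℂ] HilbertSum H₁ H₂ :=
  (equivProd H₁ H₂).symm.toContinuousLinearMap ∘L
    ContinuousLinearMap.inl ℂ H₁ H₂

variable (H₁ H₂) in
/-- The inclusion of the second summand. -/
def inrL2 : H₂ →L[ℂ] HilbertSum H₁ H₂ :=
  (equivProd H₁ H₂).symm.toContinuousLinearMap ∘L
    ContinuousLinearMap.inr ℂ H₁ H₂

theorem inlL2_apply (x : H₁) : inlL2 H₁ H₂ x = mk x 0 := rfl

theorem inrL2_apply (x : H₂) : inrL2 H₁ H₂ x = mk 0 x := rfl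

theorem directSumHom_comp_inlL2 (T : (H₁ →L[ℂ] H₁) × (H₂ →L[ℂ] H₂)) :
    directSumHom H₁ H₂ T ∘L inlL2 H₁ H₂ = inlL2 H₁ H₂ ∘L T.1 := by
  ext1 x
  simp [directSumHom_apply, inlL2_apply]

theorem directSumHom_comp_inrL2 (T : (H₁ →L[ℂ] H₁) × (H₂ →L[ℂ] H₂)) :
    directSumHom H₁ H₂ T ∘L inrL2 H₁ H₂ = inrL2 H₁ H₂ ∘L T.2 := by
  ext1 x
  simp [directSumHom_apply, inrL2_apply]

theorem adjoint_inlL2_comp_inlL2 : (inlL2 H₁ H₂).adjoint ∘L inlL2 H₁ H₂ = 1 := by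
  ext1 x
  refine ext_inner_left ℂ fun y => ?_
  simp [ContinuousLinearMap.adjoint_inner_right, inlL2_apply, inner_def]

theorem adjoint_inrL2_comp_inrL2 : (inrL2 H₁ H₂).adjoint ∘L inrL2 H₁ H₂ = 1 := by
  ext1 x
  refine ext_inner_left ℂ fun y => ?_
  simp [ContinuousLinearMap.adjoint_inner_right, inrL2_apply, inner_def]

/-- The operator on `H₁ ⊕ H₂` that interchanges the ranges of `V` and `W` and is the identity
on their complements, when `V` and `W` are isometries. -/
def swapOp (V : K →L[ℂ] H₁) (W : K →L[ℂ] H₂) : HilbertSum H₁ H₂ →L[ℂ] HilbertSum H₁ H₂ :=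
  1 - directSumHom H₁ H₂ (V ∘L V.adjoint, W ∘L W.adjoint) +
    (inlL2 H₁ H₂ ∘L V) ∘L (inrL2 H₁ H₂ ∘L W).adjoint +
    (inrL2 H₁ H₂ ∘L W) ∘L (inlL2 H₁ H₂ ∘L V).adjoint

theorem adjoint_inlL2_apply (x : HilbertSum H₁ H₂) : (inlL2 H₁ H₂).adjoint x = x.fst := by
  refine ext_inner_left ℂ fun y => ?_
  simp [ContinuousLinearMap.adjoint_inner_right, inlL2_apply, inner_def]

theorem adjoint_inrL2_apply (x : HilbertSum H₁ H₂) : (inrL2 H₁ H₂).adjoint x = x.snd := by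
  refine ext_inner_left ℂ fun y => ?_
  simp [ContinuousLinearMap.adjoint_inner_right, inrL2_apply, inner_def]

theorem swapOp_apply (V : K →L[ℂ] H₁) (W : K →L[ℂ] H₂) (x : HilbertSum H₁ H₂) :
    swapOp V W x = mk
      (x.fst - V (V.adjoint x.fst) + V (W.adjoint x.snd))
      (x.snd - W (W.adjoint x.snd) + W (V.adjoint x.fst)) := by
  simp only [swapOp, ContinuousLinearMap.adjoint_comp, ContinuousLinearMap.comp_apply,
    add_apply, sub_apply, one_apply_eq_self, directSumHom_apply, adjoint_inlL2_apply,
    adjoint_inrL2_apply, inlL2_apply, inrL2_apply]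
  refine ext' ?_ ?_ <;> simp

theorem star_swapOp (V : K →L[ℂ] H₁) (W : K →L[ℂ] H₂) : star (swapOp V W) = swapOp V W := by
  rw [ContinuousLinearMap.star_eq_adjoint, eq_comm, ContinuousLinearMap.eq_adjoint_iff]
  intro x y
  rw [swapOp_apply, swapOp_apply]
  simp only [inner_def, fst_mk, snd_mk, inner_add_left, inner_sub_left, inner_add_right,
    inner_sub_right, ← ContinuousLinearMap.adjoint_inner_right V,
    ← ContinuousLinearMap.adjoint_inner_right W, ← ContinuousLinearMap.adjoint_inner_left V,
    ← ContinuousLinearMap.adjoint_inner_left W]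
  ring

variable {V : K →L[ℂ] H₁} {W : K →L[ℂ] H₂}

theorem swapOp_mul_self (hV : V.adjoint ∘L V = 1) (hW : W.adjoint ∘L W = 1) :
    swapOp V W * swapOp V W = 1 := by
  have hV' (k) : V.adjoint (V k) = k := congrArg (fun T : K →L[ℂ] K => T k) hV
  have hW' (k) : W.adjoint (W k) = k := congrArg (fun T : K →L[ℂ] K => T k) hW
  ext1 x
  rw [mul_apply_eq_comp, swapOp_apply, swapOp_apply]
  refine ext' ?_ ?_ <;> simp [hV', hW']

/-- In the gluing, this moves the distinguished isometry of the first representation to that of the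
second. -/
theorem swapOp_comp_inl (hV : V.adjoint ∘L V = 1) :
    swapOp V W ∘L (inlL2 H₁ H₂ ∘L V) = inrL2 H₁ H₂ ∘L W := by
  have hV' (k) : V.adjoint (V k) = k := congrArg (fun T : K →L[ℂ] K => T k) hV
  ext1 x
  simp only [ContinuousLinearMap.comp_apply, swapOp_apply, inlL2_apply, inrL2_apply]
  refine ext' ?_ ?_ <;> simp [hV']

/-- `swapOp V W` commutes with a pair of representations that restrict, along `V` and `W`, to
the same representation. -/
theorem commute_swapOp {D : Type*} [CStarAlgebra D] (σ : D →⋆ₐ[ℂ] (H₁ →L[ℂ] H₁))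
    (τ : D →⋆ₐ[ℂ] (H₂ →L[ℂ] H₂)) (κ : D →⋆ₐ[ℂ] (K →L[ℂ] K))
    (hV : ∀ d, V ∘L κ d = σ d ∘L V) (hW : ∀ d, W ∘L κ d = τ d ∘L W) (d : D) :
    Commute (swapOp V W) (directSumHom H₁ H₂ (σ d, τ d)) := by
  have hV' (d k) : σ d (V k) = V (κ d k) :=
    (congrArg (fun T : K →L[ℂ] H₁ => T k) (hV d)).symm
  have hW' (d k) : τ d (W k) = W (κ d k) :=
    (congrArg (fun T : K →L[ℂ] H₂ => T k) (hW d)).symm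
  have hVa (k) : V.adjoint (σ d k) = κ d (V.adjoint k) :=
    congrArg (fun T : H₁ →L[ℂ] K => T k) (StarAlgHom.adjoint_comp_eq_of_comp_eq hV d)
  have hWa (k) : W.adjoint (τ d k) = κ d (W.adjoint k) :=
    congrArg (fun T : H₂ →L[ℂ] K => T k) (StarAlgHom.adjoint_comp_eq_of_comp_eq hW d)
  change swapOp V W * directSumHom H₁ H₂ (σ d, τ d) = directSumHom H₁ H₂ (σ d, τ d) * swapOp V W
  ext1 x
  rw [mul_apply_eq_comp, mul_apply_eq_comp, swapOp_apply, swapOp_apply, directSumHom_apply,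
    directSumHom_apply]
  simp [hV', hW', hVa, hWa]

end DirectSum

/-! ## Joint representations on Hilbert spaces -/

section HilbertRepresentation

variable {A : Type u} {B G : Type v} {N : Type*} [CStarAlgebra A] [PartialOrder A]
  [StarOrderedRing A] [CStarAlgebra B] [PartialOrder B] [StarOrderedRing B] [CStarAlgebra N]
  [NormedAddCommGroup G] [InnerProductSpace ℂ G] [CompleteSpace G]

/-- The Hilbert space form of a joint representation tuple of `φ` and `ψ`: two representations
of `A` on `H` that commute with an action `ρ` of the commutant `N` of `B`, and an isometry
`V : G → H` that intertwines the actions of `N` and compresses the representations to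
`φ` and `ψ`. -/
structure JointHilbertRepresentation (j : B →⋆ₐ[ℂ] (G →L[ℂ] G)) (r : N →⋆ₐ[ℂ] (G →L[ℂ] G))
    (φ ψ : UCP A B) where
  H : Type (max u v)
  [normedAddCommGroup : NormedAddCommGroup H]
  [innerProductSpace : InnerProductSpace ℂ H]
  [completeSpace : CompleteSpace H]
  ρ : N →⋆ₐ[ℂ] (H →L[ℂ] H)
  σ₁ : A →⋆ₐ[ℂ] (H →L[ℂ] H)
  σ₂ : A →⋆ₐ[ℂ] (H →L[ℂ] H)
  commute_left : ∀ a n, Commute (σ₁ a) (ρ n)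
  commute_right : ∀ a n, Commute (σ₂ a) (ρ n)
  V : G →L[ℂ] H
  V_comp : ∀ n, V ∘L r n = ρ n ∘L V
  apply_left : ∀ a, j (φ.1 a) = V.adjoint ∘L σ₁ a ∘L V
  apply_right : ∀ a, j (ψ.1 a) = V.adjoint ∘L σ₂ a ∘L V

attribute [instance] JointHilbertRepresentation.normedAddCommGroup
  JointHilbertRepresentation.innerProductSpace JointHilbertRepresentation.completeSpace

variable {j : B →⋆ₐ[ℂ] (G →L[ℂ] G)} {r : N →⋆ₐ[ℂ] (G →L[ℂ] G)} {φ ψ χ : UCP A B}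

namespace JointHilbertRepresentation

/-- The distance `‖σ₁ - σ₂‖_cb` of the two representations. -/
def cbDist (R : JointHilbertRepresentation j r φ ψ) : ℝ≥0∞ :=
  cbENorm (R.σ₁.toAlgHom.toLinearMap - R.σ₂.toAlgHom.toLinearMap)

/-- Unitality of `φ`, read off at `a = 1`. -/
theorem adjoint_V_comp_V (R : JointHilbertRepresentation j r φ ψ) :
    R.V.adjoint ∘L R.V = 1 := by
  have := R.apply_left 1
  rw [φ.2, map_one, map_one] at this
  exact this.symm

/-- Closedness makes the commutant a C⋆-algebra, so that cb norms of maps into it make sense. -/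
instance isClosed_centralizer {H : Type*} [NormedAddCommGroup H] [InnerProductSpace ℂ H]
    [CompleteSpace H] (s : Set (H →L[ℂ] H)) :
    IsClosed (StarSubalgebra.centralizer ℂ s : Set (H →L[ℂ] H)) := by
  rw [StarSubalgebra.coe_centralizer]
  exact Set.isClosed_centralizer _

theorem mem_centralizer_range {H : Type*} [NormedAddCommGroup H] [InnerProductSpace ℂ H]
    [CompleteSpace H] {ρ : N →⋆ₐ[ℂ] (H →L[ℂ] H)} {T : H →L[ℂ] H} (hT : ∀ n, Commute T (ρ n)) :
    T ∈ StarSubalgebra.centralizer ℂ (Set.range ρ) := by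
  rw [StarSubalgebra.mem_centralizer_iff]
  rintro _ ⟨n, rfl⟩
  rw [← map_star]
  exact ⟨(hT n).eq.symm, (hT (star n)).eq.symm⟩

/-- The joint representation tuple on the Hilbert module of intertwiners. -/
def toJointRepresentation (h : IsCommutantOf j r) (R : JointHilbertRepresentation j r φ ψ) :
    JointRepresentation φ ψ where
  E := Intertwiner h R.ρ
  σ₁ := (Intertwiner.compHom h R.ρ).comp
    (R.σ₁.codRestrict _ fun a => mem_centralizer_range (R.commute_left a))
  σ₂ := (Intertwiner.compHom h R.ρ).comp
    (R.σ₂.codRestrict _ fun a => mem_centralizer_range (R.commute_right a))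
  x := Intertwiner.ofCLM R.V R.V_comp
  inner_self_x := h.injective <| by
    rw [Intertwiner.inner_def, MulOpposite.unop_op, Intertwiner.map_coeff, map_one,
      Intertwiner.toCLM_ofCLM, R.adjoint_V_comp_V]
  apply_left a := h.injective <| by
    rw [Intertwiner.inner_def, MulOpposite.unop_op, Intertwiner.map_coeff, R.apply_left]
    rfl
  apply_right a := h.injective <| by
    rw [Intertwiner.inner_def, MulOpposite.unop_op, Intertwiner.map_coeff, R.apply_right]
    rfl

/-- Both representations take values in the commutant `C` of `ρ`. The inclusion of `C` in the
operators on `H` is completely isometric, and the action of `C` on intertwiners is completely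
contractive. -/
theorem cbDist_toJointRepresentation_le (h : IsCommutantOf j r)
    (R : JointHilbertRepresentation j r φ ψ) : (R.toJointRepresentation h).cbDist ≤ R.cbDist := by
  let C := StarSubalgebra.centralizer ℂ (Set.range R.ρ)
  let : PartialOrder C := CStarAlgebra.spectralOrder C
  have : StarOrderedRing C := CStarAlgebra.spectralOrderedRing C
  let τ₁ : A →⋆ₐ[ℂ] C := R.σ₁.codRestrict _ fun a => mem_centralizer_range (R.commute_left a)
  let τ₂ : A →⋆ₐ[ℂ] C := R.σ₂.codRestrict _ fun a => mem_centralizer_range (R.commute_right a)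
  calc (R.toJointRepresentation h).cbDist
      ≤ cbENorm (τ₁.toAlgHom.toLinearMap - τ₂.toAlgHom.toLinearMap) :=
        cbENorm_starHom_comp_le
          (Intertwiner.compHom h R.ρ).toNonUnitalStarAlgHom _ _ fun a =>
            (map_sub (Intertwiner.compHom h R.ρ) (τ₁ a) (τ₂ a)).symm
    _ ≤ R.cbDist := cbENorm_le_of_injective C.subtype.toNonUnitalStarAlgHom
        Subtype.val_injective _ _ fun a => rfl

theorem representationDist_le (h : IsCommutantOf j r) (R : JointHilbertRepresentation j r φ ψ) :
    representationDist φ ψ ≤ R.cbDist :=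
  (iInf_le _ _).trans (R.cbDist_toJointRepresentation_le h)

open scoped TensorProduct in
/-- Tensoring a joint representation tuple with the Hilbert space `G`. -/
theorem exists_of_jointRepresentation (hjr : ∀ n b, Commute (r n) (j b))
    (J : JointRepresentation φ ψ) :
    ∃ R : JointHilbertRepresentation j r φ ψ, R.cbDist ≤ J.cbDist := by
  let K : J.E →ₗ⋆[ℂ] J.E →ₗ[ℂ] B :=
    LinearMap.mk₂'ₛₗ (starRingEnd ℂ) (RingHom.id ℂ)
      (fun e f => MulOpposite.unop ⟪e, f⟫_Bᵐᵒᵖ) (by intros; simp) (by intros; simp)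
      (by intros; simp) (by intros; simp)
  have hKdef (e f) : K e f = MulOpposite.unop ⟪e, f⟫_Bᵐᵒᵖ := rfl
  let πE : HilbertModule.Adjointable Bᵐᵒᵖ J.E →ₐ[ℂ] Module.End ℂ J.E :=
    AlgHom.ofLinearMap
      { toFun := fun T => (T.toCLM : J.E →ₗ[ℂ] J.E)
        map_add' := fun _ _ => rfl
        map_smul' := fun _ _ => rfl } rfl fun _ _ => rfl
  have hπE (T e) : πE T e = T e := rfl
  obtain ⟨H, i1, i2, i3, Λ, π, ρ, hΛ, hin, hπ, hρ, hcomm⟩ :=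
    exists_correspondence j r hjr K
      (fun n e => HilbertModule.gram_nonneg e) πE
      (fun T e f => by
        rw [hKdef, hKdef, hπE, hπE, HilbertModule.Adjointable.inner_apply_left])
  -- The map `g ↦ x ⊗ g` preserves norms since `⟨x, x⟩ = 1`.
  have hV : ∃ V : G →L[ℂ] H, ∀ g, V g = Λ (J.x ⊗ₜ g) := by
    refine ⟨LinearMap.mkContinuous (Λ ∘ₗ TensorProduct.mk ℂ J.E G J.x) 1 fun g => ?_, fun g => rfl⟩
    rw [one_mul, @norm_eq_sqrt_re_inner ℂ, @norm_eq_sqrt_re_inner ℂ _ _ _ _ g]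
    simp only [LinearMap.comp_apply, TensorProduct.mk_apply, hin, hKdef, J.inner_self_x, map_one,
      one_apply_eq_self, le_refl]
  obtain ⟨V, hV⟩ := hV
  have hcompress (σ : A →⋆ₐ[ℂ] HilbertModule.Adjointable Bᵐᵒᵖ J.E) (θ : UCP A B)
      (hθ : ∀ a, θ.1 a = MulOpposite.unop ⟪J.x, σ a J.x⟫_Bᵐᵒᵖ) (a : A) :
      j (θ.1 a) = V.adjoint ∘L (π.comp σ) a ∘L V := by
    ext1 g
    refine ext_inner_left ℂ fun g' => ?_
    simp only [ContinuousLinearMap.comp_apply, StarAlgHom.comp_apply,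
      ContinuousLinearMap.adjoint_inner_right, hV, hπ, hin, hKdef, hπE, hθ]
  refine ⟨{ H := H, ρ := ρ, σ₁ := π.comp J.σ₁, σ₂ := π.comp J.σ₂
            commute_left := fun a n => hcomm _ n
            commute_right := fun a n => hcomm _ n
            V := V
            V_comp := fun n => by
              ext1 g
              simp only [ContinuousLinearMap.comp_apply, hV, hρ]
            apply_left := hcompress _ _ J.apply_left
            apply_right := hcompress _ _ J.apply_right }, ?_⟩
  exact cbENorm_starHom_comp_le π.toNonUnitalStarAlgHom _ _ fun a =>
    (map_sub π (J.σ₁ a) (J.σ₂ a)).symm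

end JointHilbertRepresentation

end HilbertRepresentation

/-! ## The Stinespring representation -/

section Stinespring

open scoped TensorProduct

variable {A : Type u} {B G : Type v} {N : Type*} [CStarAlgebra A] [PartialOrder A]
  [StarOrderedRing A] [CStarAlgebra B] [PartialOrder B] [StarOrderedRing B] [CStarAlgebra N]
  [NormedAddCommGroup G] [InnerProductSpace ℂ G] [CompleteSpace G]
  {j : B →⋆ₐ[ℂ] (G →L[ℂ] G)} {r : N →⋆ₐ[ℂ] (G →L[ℂ] G)} {φ ψ χ : UCP A B}

theorem CStarMatrix.star_mul_gram_nonneg {n : ℕ} (a : Fin n → A) :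
    0 ≤ (CStarMatrix.ofMatrix fun i k => star (a i) * a k : CStarMatrix (Fin n) (Fin n) A) := by
  cases n with
  -- Size `0` is separate because the factor `R` below needs a first row to hold the `a k`.
  | zero => exact (CStarMatrix.ext fun i => i.elim0 : (0 : CStarMatrix (Fin 0) (Fin 0) A) = _).le
  | succ n =>
    let R : CStarMatrix (Fin (n + 1)) (Fin (n + 1)) A :=
      CStarMatrix.ofMatrix fun i k => if i = 0 then a k else 0
    have : (CStarMatrix.ofMatrix fun i k => star (a i) * a k : CStarMatrix _ _ A) = star R * R := by
      ext i k
      rw [CStarMatrix.mul_apply, Fin.sum_univ_succ]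
      simp only [CStarMatrix.star_apply]
      change star (a i) * a k = star (if (0 : Fin (n + 1)) = 0 then a i else 0) *
        (if (0 : Fin (n + 1)) = 0 then a k else 0) + ∑ l : Fin n,
          star (if l.succ = 0 then a i else 0) * (if l.succ = 0 then a k else 0)
      simp [Fin.succ_ne_zero]
    rw [this]
    exact star_mul_self_nonneg R

/-- A dense image of `A ⊗ G` with the Stinespring inner product embeds isometrically into the space
of every dilation of `φ`. -/
theorem exists_isometry_of_dilation {H : Type*} [NormedAddCommGroup H] [InnerProductSpace ℂ H]
    [CompleteSpace H] {Λ : A ⊗[ℂ] G →ₗ[ℂ] H} (hΛ : DenseRange Λ)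
    (hin : ∀ a b g h, ⟪Λ (a ⊗ₜ g), Λ (b ⊗ₜ h)⟫_ℂ = ⟪g, j (φ.1 (star a * b)) h⟫_ℂ)
    {π : A →⋆ₐ[ℂ] (H →L[ℂ] H)} (hπ : ∀ a b g, π a (Λ (b ⊗ₜ g)) = Λ ((a * b) ⊗ₜ g))
    {ρ : N →⋆ₐ[ℂ] (H →L[ℂ] H)} (hρ : ∀ n a g, ρ n (Λ (a ⊗ₜ g)) = Λ (a ⊗ₜ r n g))
    {H₂ : Type*} [NormedAddCommGroup H₂] [InnerProductSpace ℂ H₂] [CompleteSpace H₂]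
    (σ : A →⋆ₐ[ℂ] (H₂ →L[ℂ] H₂)) (ρ' : N →⋆ₐ[ℂ] (H₂ →L[ℂ] H₂)) (V' : G →L[ℂ] H₂)
    (hcomm : ∀ a n, Commute (σ a) (ρ' n)) (hV' : ∀ n, V' ∘L r n = ρ' n ∘L V')
    (hφ : ∀ a, j (φ.1 a) = V'.adjoint ∘L σ a ∘L V') :
    ∃ F : H →L[ℂ] H₂, F.adjoint ∘L F = 1 ∧ (∀ a, F ∘L π a = σ a ∘L F) ∧
      (∀ n, F ∘L ρ n = ρ' n ∘L F) ∧ ∀ g, F (Λ (1 ⊗ₜ g)) = V' g := by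
  -- The only map compatible with both left actions and with `1 ⊗ g ↦ V' g`; it preserves inner
  -- products because both sides compute `φ (a⋆ b)`.
  let f : A ⊗[ℂ] G →ₗ[ℂ] H₂ := TensorProduct.lift <| LinearMap.mk₂ ℂ (fun a g => σ a (V' g))
    (by intros; simp) (by intros; simp) (by intros; simp) (by intros; simp)
  have hf (a g) : f (a ⊗ₜ g) = σ a (V' g) := rfl
  have hV'' (n g) : V' (r n g) = ρ' n (V' g) := congrArg (fun T : G →L[ℂ] H₂ => T g) (hV' n)
  obtain ⟨F, hF, hFF⟩ := exists_isometry_extension hΛ f fun s t => by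
    induction s with
    | zero => simp
    | add a b ha hb => simp only [map_add, inner_add_left, ha, hb]
    | tmul a g =>
      induction t with
      | zero => simp
      | add a b ha hb => simp only [map_add, inner_add_right, ha, hb]
      | tmul b h =>
        rw [hf, hf, hin, hφ, ContinuousLinearMap.comp_apply, ContinuousLinearMap.comp_apply,
          ContinuousLinearMap.adjoint_inner_right, map_mul, mul_apply_eq_comp,
          ← StarAlgHom.adjoint_apply, ContinuousLinearMap.adjoint_inner_right]
  refine ⟨F, hFF, fun a => ext_of_denseRange hΛ fun t => ?_,
    fun n => ext_of_denseRange hΛ fun t => ?_, fun g => ?_⟩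
  · induction t with
    | zero => simp
    | add s t hs ht => simp only [map_add, hs, ht]
    | tmul b g =>
      rw [ContinuousLinearMap.comp_apply, ContinuousLinearMap.comp_apply, hπ, hF, hF, hf, hf,
        map_mul, mul_apply_eq_comp]
  · induction t with
    | zero => simp
    | add s t hs ht => simp only [map_add, hs, ht]
    | tmul b g =>
      rw [ContinuousLinearMap.comp_apply, ContinuousLinearMap.comp_apply, hρ, hF, hF, hf, hf, hV'']
      exact congrArg (fun T : H₂ →L[ℂ] H₂ => T (V' g)) (hcomm b n).eq
  · rw [hF, hf, map_one, one_apply_eq_self]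

/-- The Stinespring representation of `φ`, and its minimality. -/
theorem exists_stinespring (hjr : ∀ n b, Commute (r n) (j b)) (φ : UCP A B) :
    ∃ R : JointHilbertRepresentation j r φ φ, R.σ₁ = R.σ₂ ∧
      ∀ (H : Type (max u v)) [NormedAddCommGroup H] [InnerProductSpace ℂ H] [CompleteSpace H]
        (σ : A →⋆ₐ[ℂ] (H →L[ℂ] H)) (ρ : N →⋆ₐ[ℂ] (H →L[ℂ] H)) (V : G →L[ℂ] H)
        (_ : ∀ a n, Commute (σ a) (ρ n)) (_ : ∀ n, V ∘L r n = ρ n ∘L V)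
        (_ : ∀ a, j (φ.1 a) = V.adjoint ∘L σ a ∘L V),
        ∃ F : R.H →L[ℂ] H, F.adjoint ∘L F = 1 ∧ (∀ a, F ∘L R.σ₁ a = σ a ∘L F) ∧
          (∀ n, F ∘L R.ρ n = ρ n ∘L F) ∧ F ∘L R.V = V := by
  let K : A →ₗ⋆[ℂ] A →ₗ[ℂ] B :=
    LinearMap.mk₂'ₛₗ (starRingEnd ℂ) (RingHom.id ℂ) (fun a b => φ.1 (star a * b))
      (by intros; simp [add_mul]) (by intros; simp) (by intros; simp [mul_add]) (by intros; simp)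
  have hKdef (a b) : K a b = φ.1 (star a * b) := rfl
  have hmul (a b : A) : Algebra.lmul ℂ A a b = a * b := rfl
  obtain ⟨H, i1, i2, i3, Λ, π, ρ, hΛ, hin, hπ, hρ, hcomm⟩ :=
    exists_correspondence j r hjr K
      -- Complete positivity of `φ` is what makes the kernel `φ (a⋆ b)` positive.
      (fun n a => CompletelyPositiveMap.map_cstarMatrix_nonneg φ.1 _
        (CStarMatrix.star_mul_gram_nonneg a)) (Algebra.lmul ℂ A)
      (fun a b c => by
        rw [hKdef, hKdef, hmul, hmul, star_mul, mul_assoc])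
  replace hin (a b g h) : ⟪Λ (a ⊗ₜ g), Λ (b ⊗ₜ h)⟫_ℂ = ⟪g, j (φ.1 (star a * b)) h⟫_ℂ :=
    hin a b g h
  replace hπ (a b g) : π a (Λ (b ⊗ₜ g)) = Λ ((a * b) ⊗ₜ g) := hπ a b g
  have hV : ∃ V : G →L[ℂ] H, ∀ g, V g = Λ (1 ⊗ₜ g) := by
    refine ⟨LinearMap.mkContinuous (Λ ∘ₗ TensorProduct.mk ℂ A G 1) 1 fun g => ?_, fun g => rfl⟩
    rw [one_mul, @norm_eq_sqrt_re_inner ℂ, @norm_eq_sqrt_re_inner ℂ _ _ _ _ g]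
    simp only [LinearMap.comp_apply, TensorProduct.mk_apply, hin, star_one, one_mul, φ.2,
      map_one, one_apply_eq_self, le_refl]
  obtain ⟨V, hV⟩ := hV
  have hcompress (a : A) : j (φ.1 a) = V.adjoint ∘L π a ∘L V := by
    ext1 g
    refine ext_inner_left ℂ fun g' => ?_
    simp only [ContinuousLinearMap.comp_apply, ContinuousLinearMap.adjoint_inner_right, hV, hπ,
      hin, star_one, one_mul, mul_one]
  refine ⟨{ H := H, ρ := ρ, σ₁ := π, σ₂ := π
            commute_left := hcomm
            commute_right := hcomm
            V := V
            V_comp := fun n => by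
              ext1 g
              simp only [ContinuousLinearMap.comp_apply, hV, hρ]
            apply_left := hcompress
            apply_right := hcompress }, rfl, ?_⟩
  intro H' _ _ _ σ ρ' V' hcomm' hV' hφ
  have hdil := exists_isometry_of_dilation (φ := φ) hΛ hin hπ hρ σ ρ' V' hcomm' hV' hφ
  obtain ⟨F, h1, h2, h3, h4⟩ := hdil
  exact ⟨F, h1, h2, h3, ContinuousLinearMap.ext fun g => (congrArg F (hV g)).trans (h4 g)⟩

end Stinespring

/-! ## Gluing joint representations -/

section Gluing

/-- Conjugation by a selfadjoint unitary. -/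
def symmetryConjHom {D : Type*} [CStarAlgebra D] (U : D) (hU : star U = U) (hUU : U * U = 1) :
    D →⋆ₐ[ℂ] D where
  toFun T := U * T * U
  map_one' := by rw [mul_one, hUU]
  map_mul' S T := by
    calc U * (S * T) * U = U * S * 1 * (T * U) := by simp only [mul_assoc, one_mul]
      _ = U * S * U * (U * T * U) := by simp only [← hUU, mul_assoc]
  map_zero' := by rw [mul_zero, zero_mul]
  map_add' S T := by rw [mul_add, add_mul]
  commutes' z := by rw [← Algebra.commutes, mul_assoc, hUU, mul_one]
  map_star' T := by rw [star_mul, star_mul, hU, mul_assoc]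

theorem symmetryConjHom_apply {D : Type*} [CStarAlgebra D] (U : D) (hU : star U = U)
    (hUU : U * U = 1) (T : D) : symmetryConjHom U hU hUU T = U * T * U := rfl

theorem symmetryConjHom_of_commute {D : Type*} [CStarAlgebra D] {U T : D} (hU : star U = U)
    (hUU : U * U = 1) (h : Commute U T) : symmetryConjHom U hU hUU T = T := by
  rw [symmetryConjHom_apply, h.eq, mul_assoc, hUU, mul_one]

variable {A : Type u} {B G : Type v} {N : Type*} [CStarAlgebra A] [PartialOrder A]
  [StarOrderedRing A] [CStarAlgebra B] [PartialOrder B] [StarOrderedRing B] [CStarAlgebra N]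
  [NormedAddCommGroup G] [InnerProductSpace ℂ G] [CompleteSpace G]
  {j : B →⋆ₐ[ℂ] (G →L[ℂ] G)} {r : N →⋆ₐ[ℂ] (G →L[ℂ] G)} {φ ψ ψ₁ ψ₂ χ : UCP A B}

theorem commute_directSumHom {H₁ H₂ : Type*} [NormedAddCommGroup H₁] [InnerProductSpace ℂ H₁]
    [CompleteSpace H₁] [NormedAddCommGroup H₂] [InnerProductSpace ℂ H₂] [CompleteSpace H₂]
    {S S' : H₁ →L[ℂ] H₁} {T T' : H₂ →L[ℂ] H₂} (hS : Commute S S') (hT : Commute T T') :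
    Commute (directSumHom H₁ H₂ (S, T)) (directSumHom H₁ H₂ (S', T')) :=
  (Commute.prod hS hT).map (directSumHom H₁ H₂)

namespace JointHilbertRepresentation

/-- Two joint representations whose vectors factor through isometric copies of the same space `K`,
glued by interchanging the two copies of `K` in the direct sum. -/
def glue (R₁ : JointHilbertRepresentation j r φ ψ₁) (R₂ : JointHilbertRepresentation j r ψ₂ χ)
    {K : Type*} [NormedAddCommGroup K] [InnerProductSpace ℂ K] [CompleteSpace K]
    (κ : N →⋆ₐ[ℂ] (K →L[ℂ] K)) (W : G →L[ℂ] K) (F₁ : K →L[ℂ] R₁.H) (F₂ : K →L[ℂ] R₂.H)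
    (h₁ : F₁.adjoint ∘L F₁ = 1) (h₂ : F₂.adjoint ∘L F₂ = 1)
    (hκ₁ : ∀ n, F₁ ∘L κ n = R₁.ρ n ∘L F₁) (hκ₂ : ∀ n, F₂ ∘L κ n = R₂.ρ n ∘L F₂)
    (hW₁ : F₁ ∘L W = R₁.V) (hW₂ : F₂ ∘L W = R₂.V) : JointHilbertRepresentation j r φ χ where
  H := HilbertSum R₁.H R₂.H
  ρ := (directSumHom R₁.H R₂.H).comp (R₁.ρ.prod R₂.ρ)
  σ₁ := (directSumHom R₁.H R₂.H).comp (R₁.σ₁.prod R₂.σ₁)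
  σ₂ := (symmetryConjHom (swapOp F₁ F₂) (star_swapOp F₁ F₂) (swapOp_mul_self h₁ h₂)).comp
    ((directSumHom R₁.H R₂.H).comp (R₁.σ₂.prod R₂.σ₂))
  commute_left a n := commute_directSumHom (R₁.commute_left a n) (R₂.commute_left a n)
  commute_right a n := by
    -- The swap respects `N` since both embeddings of `K` intertwine its action.
    have hU := commute_swapOp R₁.ρ R₂.ρ κ hκ₁ hκ₂ n
    exact (hU.mul_left
      (commute_directSumHom (R₁.commute_right a n) (R₂.commute_right a n))).mul_left hU
  V := inlL2 R₁.H R₂.H ∘L R₁.V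
  V_comp n := by
    change _ = directSumHom R₁.H R₂.H (R₁.ρ n, R₂.ρ n) ∘L inlL2 R₁.H R₂.H ∘L R₁.V
    rw [← ContinuousLinearMap.comp_assoc, directSumHom_comp_inlL2, ContinuousLinearMap.comp_assoc,
      ContinuousLinearMap.comp_assoc, R₁.V_comp]
  apply_left a := by
    change _ = _ ∘L directSumHom R₁.H R₂.H (R₁.σ₁ a, R₂.σ₁ a) ∘L inlL2 R₁.H R₂.H ∘L R₁.V
    rw [← ContinuousLinearMap.comp_assoc (directSumHom R₁.H R₂.H _), directSumHom_comp_inlL2,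
      ContinuousLinearMap.adjoint_comp, R₁.apply_left]
    calc R₁.V.adjoint ∘L R₁.σ₁ a ∘L R₁.V
        = R₁.V.adjoint ∘L ((inlL2 R₁.H R₂.H).adjoint ∘L inlL2 R₁.H R₂.H) ∘L R₁.σ₁ a ∘L R₁.V := by
          rw [adjoint_inlL2_comp_inlL2]; rfl
      _ = _ := rfl
  apply_right a := by
    -- The swap moves the isometry into the second summand, so compressing the conjugated
    -- representation only sees `R₂.σ₂`.
    have hswap : swapOp F₁ F₂ ∘L (inlL2 R₁.H R₂.H ∘L R₁.V) = inrL2 R₁.H R₂.H ∘L R₂.V := by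
      rw [← hW₁, ← hW₂, ← ContinuousLinearMap.comp_assoc, ← ContinuousLinearMap.comp_assoc,
        ContinuousLinearMap.comp_assoc (swapOp F₁ F₂), swapOp_comp_inl h₁]
      rfl
    have hswap' : (inlL2 R₁.H R₂.H ∘L R₁.V).adjoint ∘L swapOp F₁ F₂ =
        (inrL2 R₁.H R₂.H ∘L R₂.V).adjoint := by
      rw [← hswap, ContinuousLinearMap.adjoint_comp (swapOp F₁ F₂),
        ← ContinuousLinearMap.star_eq_adjoint (swapOp F₁ F₂), star_swapOp]
    calc j (χ.1 a) = R₂.V.adjoint ∘L R₂.σ₂ a ∘L R₂.V := R₂.apply_right a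
      _ = R₂.V.adjoint ∘L ((inrL2 R₁.H R₂.H).adjoint ∘L inrL2 R₁.H R₂.H) ∘L R₂.σ₂ a ∘L R₂.V := by
          rw [adjoint_inrL2_comp_inrL2]; rfl
      _ = (inrL2 R₁.H R₂.H ∘L R₂.V).adjoint ∘L
          (inrL2 R₁.H R₂.H ∘L R₂.σ₂ a) ∘L R₂.V := by
          rw [ContinuousLinearMap.adjoint_comp]; rfl
      _ = (inrL2 R₁.H R₂.H ∘L R₂.V).adjoint ∘L
          (directSumHom R₁.H R₂.H (R₁.σ₂ a, R₂.σ₂ a) ∘L inrL2 R₁.H R₂.H) ∘L R₂.V := by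
          rw [directSumHom_comp_inrL2]
      _ = ((inlL2 R₁.H R₂.H ∘L R₁.V).adjoint ∘L swapOp F₁ F₂) ∘L
          directSumHom R₁.H R₂.H (R₁.σ₂ a, R₂.σ₂ a) ∘L
            (swapOp F₁ F₂ ∘L (inlL2 R₁.H R₂.H ∘L R₁.V)) := by
          rw [hswap, hswap']; rfl
      _ = _ := rfl

/-- The intermediate representation `β = R₁.σ₂ ⊕ R₂.σ₁` commutes with the swap, because both of its
parts restrict to `π` on `K`. Hence it can be compared with `σ₁` in the first summand only and,
after conjugation, with `σ₂` in the second only. -/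
theorem cbDist_glue_le (R₁ : JointHilbertRepresentation j r φ ψ₁)
    (R₂ : JointHilbertRepresentation j r ψ₂ χ)
    {K : Type*} [NormedAddCommGroup K] [InnerProductSpace ℂ K] [CompleteSpace K]
    (κ : N →⋆ₐ[ℂ] (K →L[ℂ] K)) (W : G →L[ℂ] K) (F₁ : K →L[ℂ] R₁.H) (F₂ : K →L[ℂ] R₂.H)
    (h₁ : F₁.adjoint ∘L F₁ = 1) (h₂ : F₂.adjoint ∘L F₂ = 1)
    (hκ₁ : ∀ n, F₁ ∘L κ n = R₁.ρ n ∘L F₁) (hκ₂ : ∀ n, F₂ ∘L κ n = R₂.ρ n ∘L F₂)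
    (hW₁ : F₁ ∘L W = R₁.V) (hW₂ : F₂ ∘L W = R₂.V)
    (π : A →⋆ₐ[ℂ] (K →L[ℂ] K)) (hπ₁ : ∀ a, F₁ ∘L π a = R₁.σ₂ a ∘L F₁)
    (hπ₂ : ∀ a, F₂ ∘L π a = R₂.σ₁ a ∘L F₂) :
    (glue R₁ R₂ κ W F₁ F₂ h₁ h₂ hκ₁ hκ₂ hW₁ hW₂).cbDist ≤ R₁.cbDist + R₂.cbDist := by
  let Δ := directSumHom R₁.H R₂.H
  let β : A →⋆ₐ[ℂ] (HilbertSum R₁.H R₂.H →L[ℂ] HilbertSum R₁.H R₂.H) :=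
    Δ.comp (R₁.σ₂.prod R₂.σ₁)
  let Γ := symmetryConjHom (swapOp F₁ F₂) (star_swapOp F₁ F₂) (swapOp_mul_self h₁ h₂)
  have hβ (a) : Γ (β a) = β a :=
    symmetryConjHom_of_commute _ _ (commute_swapOp R₁.σ₂ R₂.σ₁ π hπ₁ hπ₂ a)
  refine (cbENorm_sub_le_sub_add_sub _ β.toAlgHom.toLinearMap _).trans (add_le_add ?_ ?_)
  · refine cbENorm_starHom_comp_le (Δ.toNonUnitalStarAlgHom.comp
      (NonUnitalStarAlgHom.inl ℂ (R₁.H →L[ℂ] R₁.H) (R₂.H →L[ℂ] R₂.H))) _ _ fun a => ?_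
    change Δ (R₁.σ₁ a, R₂.σ₁ a) - Δ (R₁.σ₂ a, R₂.σ₁ a) = Δ (R₁.σ₁ a - R₁.σ₂ a, 0)
    rw [← map_sub, Prod.mk_sub_mk, sub_self]
  · refine cbENorm_starHom_comp_le ((Γ.comp Δ).toNonUnitalStarAlgHom.comp
      (NonUnitalStarAlgHom.inr ℂ (R₁.H →L[ℂ] R₁.H) (R₂.H →L[ℂ] R₂.H))) _ _ fun a => ?_
    change β a - Γ (Δ (R₁.σ₂ a, R₂.σ₂ a)) = Γ (Δ (0, R₂.σ₁ a - R₂.σ₂ a))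
    rw [← hβ, ← map_sub]
    change Γ (Δ (R₁.σ₂ a, R₂.σ₁ a) - Δ (R₁.σ₂ a, R₂.σ₂ a)) = _
    rw [← map_sub, Prod.mk_sub_mk, sub_self]

end JointHilbertRepresentation

end Gluing

/-! ## The representation distance is a metric -/

section Metric

variable {A : Type u} {B G : Type v} {N : Type*} [CStarAlgebra A] [PartialOrder A]
  [StarOrderedRing A] [CStarAlgebra B] [PartialOrder B] [StarOrderedRing B] [CStarAlgebra N]
  [NormedAddCommGroup G] [InnerProductSpace ℂ G] [CompleteSpace G]
  {j : B →⋆ₐ[ℂ] (G →L[ℂ] G)} {r : N →⋆ₐ[ℂ] (G →L[ℂ] G)}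

/-- Gluing along `G` itself, embedded by the two Stinespring isometries, needs no compatibility of
the actions of `A`; any two representations are at cb distance at most `2`. -/
theorem representationDist_ne_top (h : IsCommutantOf j r) (φ χ : UCP A B) :
    representationDist φ χ ≠ ∞ := by
  obtain ⟨R₁, -⟩ := exists_stinespring h.commute φ
  obtain ⟨R₂, -⟩ := exists_stinespring h.commute χ
  have hle := (R₁.glue R₂ r 1 R₁.V R₂.V R₁.adjoint_V_comp_V R₂.adjoint_V_comp_V R₁.V_comp
    R₂.V_comp rfl rfl).representationDist_le h
  exact ne_top_of_le_ne_top ENNReal.ofNat_ne_top (hle.trans (cbENorm_starAlgHom_sub_le _ _))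

theorem representationDist_self (h : IsCommutantOf j r) (φ : UCP A B) :
    representationDist φ φ = 0 := by
  obtain ⟨R, hR, -⟩ := exists_stinespring h.commute φ
  refine le_antisymm ((R.representationDist_le h).trans ?_) zero_le
  rw [JointHilbertRepresentation.cbDist, hR, sub_self]
  refine cbENorm_le_of_forall fun n M _ => ?_
  have : M.map (0 : A →ₗ[ℂ] (R.H →L[ℂ] R.H)) = 0 := by ext; rfl
  exact (enorm_eq_zero.2 this).le

/-- Exchanging the two left actions of a joint representation tuple. -/
def JointRepresentation.symm {φ ψ : UCP A B} (J : JointRepresentation φ ψ) :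
    JointRepresentation ψ φ where
  E := J.E
  σ₁ := J.σ₂
  σ₂ := J.σ₁
  x := J.x
  inner_self_x := J.inner_self_x
  apply_left := J.apply_right
  apply_right := J.apply_left

theorem JointRepresentation.cbDist_symm {φ ψ : UCP A B} (J : JointRepresentation φ ψ) :
    J.symm.cbDist = J.cbDist :=
  cbENorm_sub_comm J.σ₂.toAlgHom.toLinearMap J.σ₁.toAlgHom.toLinearMap

theorem representationDist_comm_le (φ ψ : UCP A B) :
    representationDist φ ψ ≤ representationDist ψ φ :=
  le_iInf fun J => (iInf_le _ J.symm).trans J.cbDist_symm.le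

theorem representationDist_triangle (h : IsCommutantOf j r) (φ ψ χ : UCP A B) :
    representationDist φ χ ≤ representationDist φ ψ + representationDist ψ χ := by
  rw [representationDist.eq_def φ ψ, representationDist.eq_def ψ χ, ENNReal.iInf_add]
  refine le_iInf fun J₁ => ?_
  rw [ENNReal.add_iInf]
  refine le_iInf fun J₂ => ?_
  obtain ⟨R₁, hR₁⟩ := JointHilbertRepresentation.exists_of_jointRepresentation h.commute J₁
  obtain ⟨R₂, hR₂⟩ := JointHilbertRepresentation.exists_of_jointRepresentation h.commute J₂
  -- `ψ` is dilated by the second representation of `R₁` and by the first of `R₂`; minimality puts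
  -- its Stinespring space inside both.
  obtain ⟨R, -, hR⟩ := exists_stinespring h.commute ψ
  obtain ⟨F₁, h₁, hπ₁, hκ₁, hW₁⟩ :=
    hR R₁.H R₁.σ₂ R₁.ρ R₁.V R₁.commute_right R₁.V_comp R₁.apply_right
  obtain ⟨F₂, h₂, hπ₂, hκ₂, hW₂⟩ :=
    hR R₂.H R₂.σ₁ R₂.ρ R₂.V R₂.commute_left R₂.V_comp R₂.apply_left
  exact ((R₁.glue R₂ R.ρ R.V F₁ F₂ h₁ h₂ hκ₁ hκ₂ hW₁ hW₂).representationDist_le h).trans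
    ((R₁.cbDist_glue_le R₂ R.ρ R.V F₁ F₂ h₁ h₂ hκ₁ hκ₂ hW₁ hW₂ R.σ₁ hπ₁ hπ₂).trans
      (add_le_add hR₁ hR₂))

/-- For every joint tuple, `φ - ψ` is the compression of `σ₁ - σ₂` by `x`. -/
theorem cbENorm_sub_le_representationDist (φ ψ : UCP A B) :
    cbENorm (φ.1.toLinearMap - ψ.1.toLinearMap) ≤ representationDist φ ψ :=
  le_iInf fun J => by
    refine HilbertModule.cbENorm_compression_le J.x
      (MulOpposite.unop_injective J.inner_self_x) _ _ fun a => ?_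
    change φ.1 a - ψ.1 a = MulOpposite.unop ⟪J.x, J.σ₁ a J.x - J.σ₂ a J.x⟫_Bᵐᵒᵖ
    rw [CStarModule.inner_sub_right, MulOpposite.unop_sub, J.apply_left, J.apply_right]

theorem opENorm_sub_le_representationDist (φ ψ : UCP A B) :
    opENorm (φ.1.toLinearMap - ψ.1.toLinearMap) ≤ representationDist φ ψ :=
  (opENorm_le_cbENorm _).trans (cbENorm_sub_le_representationDist φ ψ)

theorem eq_of_opENorm_sub_eq_zero {φ ψ : UCP A B}
    (h : opENorm (φ.1.toLinearMap - ψ.1.toLinearMap) = 0) : φ = ψ := by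
  have h0 (a : A) (ha : ‖a‖ ≤ 1) : φ.1 a = ψ.1 a := by
    have h1 : ‖(φ.1.toLinearMap - ψ.1.toLinearMap) a‖ₑ ≤ 0 :=
      h ▸ le_iSup₂_of_le (f := fun (a : A) (_ : ‖a‖ ≤ 1) =>
        ‖(φ.1.toLinearMap - ψ.1.toLinearMap) a‖ₑ) a ha le_rfl
    exact sub_eq_zero.1 (enorm_eq_zero.1 (le_antisymm h1 zero_le))
  refine Subtype.ext (DFunLike.ext _ _ fun a => ?_)
  -- Rescaling by `1 + ‖a‖` reaches the unit ball without treating `a = 0` separately.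
  have hpos : (0 : ℝ) < 1 + ‖a‖ := by positivity
  have hc : ((1 + ‖a‖ : ℝ) : ℂ) ≠ 0 := Complex.ofReal_ne_zero.2 hpos.ne'
  have h2 := h0 (((1 + ‖a‖ : ℝ) : ℂ)⁻¹ • a) <| by
    rw [norm_smul, norm_inv, Complex.norm_real, Real.norm_of_nonneg hpos.le, inv_mul_le_iff₀ hpos]
    linarith
  rw [map_smul, map_smul] at h2
  exact smul_right_injective B (inv_ne_zero hc) h2

/-- `N` is the commutant of `S`, acting by inclusion; `S'' = S` then identifies `B` with the
commutant of `N`. -/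
theorem isCommutantOf_of_vonNeumannAlgebra {B G : Type*} [CStarAlgebra B] [NormedAddCommGroup G]
    [InnerProductSpace ℂ G] [CompleteSpace G] (S : VonNeumannAlgebra G)
    (ι : B ≃⋆ₐ[ℂ] S.toStarSubalgebra) :
    ∃ (j : B →⋆ₐ[ℂ] (G →L[ℂ] G))
      (r : StarSubalgebra.centralizer ℂ (S : Set (G →L[ℂ] G)) →⋆ₐ[ℂ] (G →L[ℂ] G)),
      IsCommutantOf j r := by
  refine ⟨S.toStarSubalgebra.subtype.comp (ι : B →⋆ₐ[ℂ] S.toStarSubalgebra),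
    StarSubalgebra.subtype _, Subtype.val_injective.comp ι.injective, fun n b => ?_,
    fun T hT => ?_⟩
  · exact (((StarSubalgebra.mem_centralizer_iff ℂ).1 n.2 _ (ι b).2).1).symm
  · have hTS : T ∈ S := by
      rw [← S.commutant_commutant, VonNeumannAlgebra.mem_commutant_iff]
      exact fun n hn => (hT ⟨n, hn⟩).eq
    exact ⟨ι.symm ⟨T, hTS⟩, congrArg Subtype.val (ι.apply_symm_apply ⟨T, hTS⟩)⟩

end Metric

end

theorem mainTheorem1
    {A : Type u} {B : Type v} {G : Type v}
    [CStarAlgebra A] [PartialOrder A] [StarOrderedRing A]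
    [CStarAlgebra B] [PartialOrder B] [StarOrderedRing B]
    [NormedAddCommGroup G] [InnerProductSpace ℂ G] [CompleteSpace G]
    -- `B` is a von Neumann algebra, acting faithfully on the Hilbert space `G`
    (S : VonNeumannAlgebra G) (_ι : B ≃⋆ₐ[ℂ] S.toStarSubalgebra) :
    -- `γ` is a metric on `UCP(A, B)`
    (∀ φ ψ : UCP A B, representationDist φ ψ ≠ ∞) ∧
    (∀ φ ψ : UCP A B, representationDist φ ψ = 0 ↔ φ = ψ) ∧
    (∀ φ ψ : UCP A B, representationDist φ ψ = representationDist ψ φ) ∧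
    (∀ φ ψ χ : UCP A B,
      representationDist φ χ ≤ representationDist φ ψ + representationDist ψ χ) ∧
    -- it dominates the operator norm distance and even the completely bounded distance
    (∀ φ ψ : UCP A B,
      opENorm (φ.1.toLinearMap - ψ.1.toLinearMap) ≤ representationDist φ ψ ∧
      cbENorm (φ.1.toLinearMap - ψ.1.toLinearMap) ≤ representationDist φ ψ) := by
  obtain ⟨j, r, h⟩ := isCommutantOf_of_vonNeumannAlgebra S _ι
  refine ⟨representationDist_ne_top h, fun φ ψ => ⟨fun h0 => ?_, ?_⟩, fun φ ψ =>
    le_antisymm (representationDist_comm_le φ ψ) (representationDist_comm_le ψ φ),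
    representationDist_triangle h, fun φ ψ => ⟨opENorm_sub_le_representationDist φ ψ,
      cbENorm_sub_le_representationDist φ ψ⟩⟩
  · exact eq_of_opENorm_sub_eq_zero
      (le_antisymm (h0 ▸ opENorm_sub_le_representationDist φ ψ) zero_le)
  · rintro rfl
    exact representationDist_self h φ
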